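/- Let $m$ be an odd natural number. For $x\in\mathbb R$ put $$G_m(x)=\frac{\operatorname{sgn}x}{2m}\Bigl(\sinh x+\sum_{n=1}^{m-1}e^{x\cos\frac{\pi n}{m}}\cos\bigl(x\sin\tfrac{\pi n}{m}+\tfrac{\pi n}{m}\bigr)\Bigr),$$ which is a fundamental solution of $\frac{d^{2m}}{dx^{2m}}-1$. For $h>0$ and $k=1,\dots,\frac{m-1}{2}$ put $$a_{1,k}=2\bigl[\cos\tfrac{\pi k}{m}\cos(h\sin\tfrac{\pi k}{m})\sinh(h\cos\tfrac{\pi k}{m})-\sin\tfrac{\pi k}{m}\sin(h\sin\tfrac{\pi k}{m})\cosh(h\cos\tfrac{\pi k}{m})\bigr],$$ $$a_{2,k}=-2\bigl[\cos\tfrac{\pi k}{m}\sinh(2h\cos\tfrac{\pi k}{m})-\sin\tfrac{\pi k}{m}\sin(2h\sin\tfrac{\pi k}{m})\bigr],$$ $$b_{1,k}=-4\cos(h\sin\tfrac{\pi k}{m})\cosh(h\cos\tfrac{\pi k}{m}),\qquad b_{2,k}=2\bigl[1+\cos(2h\sin\tfrac{\pi k}{m})+\cosh(2h\cos\tfrac{\pi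 k}{m})\bigr],$$ $$K=\sum_{k=1}^{\frac{m-1}{2}}a_{1,k}+\sinh h,\qquad M_1=\sum_{k=1}^{\frac{m-1}{2}}b_{1,k}-2\cosh h,$$ $$K_1=\sum_{k=1}^{\frac{m-1}{2}}\Bigl(b_{1,k}\sinh h+a_{2,k}+a_{1,k}\Bigl(\sum_{j\ne k}b_{1,j}-2\cosh h\Bigr)\Bigr),$$ $$B_{2m-2}(\lambda)=\prod_{k=1}^{\frac{m-1}{2}}\bigl(\lambda^4+b_{1,k}\lambda^3+b_{2,k}\lambda^2+b_{1,k}\lambda+1\bigr),$$ $$\mathcal P_{2m-2}(\lambda)=\Bigl(\sinh h+(\lambda^2-2\lambda\cosh h+1)\sum_{j=1}^{\frac{m-1}{2}}\frac{a_{1,j}\lambda^2+a_{2,j}\lambda+a_{1,j}}{\lambda^4+b_{1,j}\lambda^3+b_{2,j}\lambda^2+b_{1,j}\lambda+1}\Bigr)B_{2m-2}(\lambda),$$ the last being a polynomial in $\lambda$, whose coefficient at $\lambda^{2m-2}$ is $K$. Then there is $h_0=h_0(m)>0$ such that for every $h\in(0,h_0)$ the following holds. One has $K\neq0$, and $\mathcal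 P_{2m-2}$ has exactly $m-1$ distinct complex roots $\lambda_1,\dots,\lambda_{m-1}$ with $|\lambda_n|<1$; they are simple and nonzero. There is exactly one function $\beta\mapsto D_m(h\beta)$, $\beta\in\mathbb Z$, such that for all $\beta\in\mathbb Z$ $$\sum_{\gamma\in\mathbb Z}D_m(h\gamma)\,G_m(h\beta-h\gamma)=\begin{cases}1,&\beta=0,\\0,&\beta\ne0,\end{cases}$$ with absolutely convergent series, namely $$D_m(h\beta)=\frac mK\begin{cases}\displaystyle\sum_{n=1}^{m-1}A_n\lambda_n^{|\beta|-1},&|\beta|\ge2,\\[1mm]\displaystyle 1+\sum_{n=1}^{m-1}A_n,&|\beta|=1,\\[1mm]\displaystyle M_1-\frac{K_1}{K}+\sum_{n=1}^{m-1}\frac{A_n}{\lambda_n},&\beta=0,\end{cases} \qquad A_n=\frac{K\,(\lambda_n^2-2\lambda_n\cosh h+1)\,B_{2m-2}(\lambda_n)}{\lambda_n\,\mathcal P_{2m-2}'(\lambda_n)}.$$ -/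

import Mathlib

open Polynomial

noncomputable section

namespace DiscreteAnalogue

/-- The fundamental solution `G_m` of `d^{2m}/dx^{2m} - 1` (for odd `m`). -/
def G (m : ℕ) (x : ℝ) : ℝ :=
  Real.sign x / (2 * m) *
    (Real.sinh x + ∑ n ∈ Finset.Icc 1 (m - 1),
      Real.exp (x * Real.cos (Real.pi * n / m)) *
        Real.cos (x * Real.sin (Real.pi * n / m) + Real.pi * n / m))

/-- The discrete delta function. -/
def discreteDelta (β : ℤ) : ℂ := if β = 0 then 1 else 0

/-- The convolution of the functions of a discrete argument `f` and `g`,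
`(f * g) β = ∑_{γ ∈ ℤ} f γ * g (β - γ)`, exists at every `β ∈ ℤ`
(as an unconditionally convergent series) and is equal to `s`. -/
def HasConvolution (f g s : ℤ → ℂ) : Prop :=
  ∀ β : ℤ, HasSum (fun γ : ℤ => f γ * g (β - γ)) (s β)

/-- `D`, as a function on the grid `h ℤ`, solves `D(hβ) * G_m(hβ) = δ_d(hβ)`;
here `D β` stands for the value `D(hβ)`. -/
def IsDiscreteAnalogue (m : ℕ) (h : ℝ) (D : ℤ → ℂ) : Prop :=
  HasConvolution D (fun β : ℤ => ((G m (h * β) : ℝ) : ℂ)) discreteDelta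

/-- The coefficient `a_{1,k}`. -/
def a₁ (m : ℕ) (h : ℝ) (k : ℕ) : ℝ :=
  2 * (Real.cos (Real.pi * k / m) * Real.cos (h * Real.sin (Real.pi * k / m)) *
        Real.sinh (h * Real.cos (Real.pi * k / m))
      - Real.sin (Real.pi * k / m) * Real.sin (h * Real.sin (Real.pi * k / m)) *
        Real.cosh (h * Real.cos (Real.pi * k / m)))

/-- The coefficient `a_{2,k}`. -/
def a₂ (m : ℕ) (h : ℝ) (k : ℕ) : ℝ :=
  -2 * (Real.cos (Real.pi * k / m) * Real.sinh (2 * h * Real.cos (Real.pi * k / m))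
      - Real.sin (Real.pi * k / m) * Real.sin (2 * h * Real.sin (Real.pi * k / m)))

/-- The coefficient `b_{1,k}`. -/
def b₁ (m : ℕ) (h : ℝ) (k : ℕ) : ℝ :=
  -4 * (Real.cos (h * Real.sin (Real.pi * k / m)) * Real.cosh (h * Real.cos (Real.pi * k / m)))

/-- The coefficient `b_{2,k}`. -/
def b₂ (m : ℕ) (h : ℝ) (k : ℕ) : ℝ :=
  2 * (1 + Real.cos (2 * h * Real.sin (Real.pi * k / m))
      + Real.cosh (2 * h * Real.cos (Real.pi * k / m)))

/-- The index set `{1, …, (m - 1) / 2}`. -/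
def idx (m : ℕ) : Finset ℕ := Finset.Icc 1 ((m - 1) / 2)

/-- The quartic factor `λ⁴ + b_{1,k} λ³ + b_{2,k} λ² + b_{1,k} λ + 1`. -/
def quartic (m : ℕ) (h : ℝ) (k : ℕ) : ℝ[X] :=
  X ^ 4 + C (b₁ m h k) * X ^ 3 + C (b₂ m h k) * X ^ 2 + C (b₁ m h k) * X + 1

/-- The quadratic `λ² - 2 λ cosh h + 1`. -/
def quad (h : ℝ) : ℝ[X] := X ^ 2 - C (2 * Real.cosh h) * X + 1

/-- The polynomial `B_{2m-2}`. -/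
def B (m : ℕ) (h : ℝ) : ℝ[X] := ∏ k ∈ idx m, quartic m h k

/-- The polynomial `𝒫_{2m-2}`, that is
`(sinh h + (λ² - 2 λ cosh h + 1) ∑_j (a_{1,j} λ² + a_{2,j} λ + a_{1,j}) / quartic_j) * B_{2m-2}`
with the product by `B_{2m-2} = ∏_k quartic_k` carried out in every summand. -/
def P (m : ℕ) (h : ℝ) : ℝ[X] :=
  C (Real.sinh h) * B m h +
    quad h * ∑ j ∈ idx m,
      (C (a₁ m h j) * X ^ 2 + C (a₂ m h j) * X + C (a₁ m h j)) *
        ∏ k ∈ (idx m).erase j, quartic m h k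

/-- The number `K` (the coefficient of `λ^{2m-2}` in `𝒫_{2m-2}`). -/
def K (m : ℕ) (h : ℝ) : ℝ := ∑ k ∈ idx m, a₁ m h k + Real.sinh h

/-- The number `K₁`. -/
def K₁ (m : ℕ) (h : ℝ) : ℝ :=
  ∑ k ∈ idx m,
    (b₁ m h k * Real.sinh h + a₂ m h k +
      a₁ m h k * (∑ j ∈ (idx m).erase k, b₁ m h j - 2 * Real.cosh h))

/-- The number `M₁`. -/
def M₁ (m : ℕ) (h : ℝ) : ℝ := ∑ k ∈ idx m, b₁ m h k - 2 * Real.cosh h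

/-- The coefficient `A_n` that belongs to the root `z = λ_n` of `𝒫_{2m-2}`. The factor `K`
accounts for `𝒫_{2m-2}` having leading coefficient `K`: the formula is
`(z² - 2 z cosh h + 1) B(z) / (z Q'(z))` for the monic polynomial `Q = 𝒫_{2m-2} / K`. -/
def A (m : ℕ) (h : ℝ) (z : ℂ) : ℂ :=
  (K m h : ℂ) * (aeval z (quad h) * aeval z (B m h)) / (z * aeval z (derivative (P m h)))

/-- The explicit discrete function built from the numbers `λ_n`; its value at `β : ℤ` is
the value at the grid point `hβ`. -/
def explicitD (m : ℕ) (h : ℝ) (lam : Fin (m - 1) → ℂ) (β : ℤ) : ℂ :=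
  (m : ℂ) / (K m h : ℂ) *
    if β = 0 then
      (M₁ m h : ℂ) - (K₁ m h : ℂ) / (K m h : ℂ) + ∑ n, A m h (lam n) / lam n
    else if β.natAbs = 1 then
      1 + ∑ n, A m h (lam n)
    else
      ∑ n, A m h (lam n) * lam n ^ (β.natAbs - 1)

end DiscreteAnalogue

end

noncomputable section

namespace DiscreteAnalogue

/-! Put w_n = e^{iπn/m} for n < m, c_n = 2 cosh(h w_n), N = ∏ (X − c_n) (`nodePoly`) and R = ∑ w_n
sinh(h w_n) ∏_{j≠n} (X − c_j) (`numPoly`). Pairing n with m − n identifies the real data: quad · B =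
z^m N(z + 1/z) and P = z^(m−1) R(z + 1/z). The two top coefficients of R are K and K₁, and M₁ is the
second coefficient of N.

On the grid, G is (1/2m) ∑ w_n sinh(h w_n |β|). Let T f(β) = f(β+1) + f(β−1) (`neighborSum`). Since
T − 2 cosh a sends sinh(a|β|) to 2 sinh(a) δ, one gets m N(T) G = R(T) δ, so the inverse should be D
= m (N/R)(T) δ. As T − (λ + 1/λ) sends λ^|β| to (λ − 1/λ) δ, partial fractions of N/R produce the
explicit formula (`partial_fractions`, `explicitD_eq`). `hasConvolution_delta_iff` makes this
rigorous: polynomials in T pass through convolutions, and coprimality of R and mN removes the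
ambiguity left by the kernels of these operators.

What remains is to find m − 1 distinct roots with |λ| < e^{−h}, a bound that beats the growth
e^{h|β|} of G. By `mul_aeval_P_eq_rootSum`, z P(z) / (quad · B) is half the sum of w φ(hw) over all
2m-th roots of unity w, where φ(t) = 1/(1 − z e^t). As h → 0 its leading term is governed by the
Taylor coefficient of φ of order 2m − 1, which is a polynomial in s = 1/(1 − z) (`logisticPoly`, of
Eulerian type). Rolle's theorem and the symmetry s ↦ 1 − s give it m − 1 simple roots in (1/2, 1),
that is, z in (−1, 0). The sign changes survive for small h and give roots of P. These exhaust the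
degree of R, so they are all the roots of P in the disc, and K ≠ 0 follows. -/

/-- The point `exp (i π n / m)`; for `n < m` these represent the `2m`-th roots of unity up to
sign. -/
def halfRoot (m n : ℕ) : ℂ := Complex.exp ((Real.pi * n / m : ℝ) * Complex.I)

/-- The number `2 cosh (h w_n)`. -/
def node (m : ℕ) (h : ℝ) (n : ℕ) : ℂ := 2 * Complex.cosh (h * halfRoot m n)

/-- The number `w_n sinh (h w_n)`. -/
def weight (m : ℕ) (h : ℝ) (n : ℕ) : ℂ := halfRoot m n * Complex.sinh (h * halfRoot m n)

/-- The polynomial `∏ (X - 2 cosh (h w_n))`. -/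
def nodePoly (m : ℕ) (h : ℝ) : ℂ[X] := ∏ n ∈ Finset.range m, (X - C (node m h n))

/-- The numerator of `∑ w_n sinh (h w_n) / (X - 2 cosh (h w_n))`. -/
def numPoly (m : ℕ) (h : ℝ) : ℂ[X] :=
  ∑ n ∈ Finset.range m, C (weight m h n) * ∏ j ∈ (Finset.range m).erase n, (X - C (node m h j))

/-! ### The symmetry of the roots of unity and the real coefficients -/

theorem halfRoot_eq (m n : ℕ) : halfRoot m n =
    (Real.cos (Real.pi * n / m) : ℂ) + (Real.sin (Real.pi * n / m) : ℂ) * Complex.I := by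
  rw [halfRoot, Complex.exp_mul_I, Complex.ofReal_cos, Complex.ofReal_sin]

theorem halfRoot_zero (m : ℕ) : halfRoot m 0 = 1 := by simp [halfRoot]

theorem node_zero (m : ℕ) (h : ℝ) : node m h 0 = ((2 * Real.cosh h : ℝ) : ℂ) := by
  simp [node, halfRoot_zero]

theorem weight_zero (m : ℕ) (h : ℝ) : weight m h 0 = (Real.sinh h : ℂ) := by
  simp [weight, halfRoot_zero]

theorem norm_halfRoot (m n : ℕ) : ‖halfRoot m n‖ = 1 := Complex.norm_exp_ofReal_mul_I _

/-- Reflection of the index is w ↦ −conj w. Both cosh(hw) and w sinh(hw) are even in w, so it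
conjugates nodes and weights, and each pair k, m − k contributes real quantities. -/
theorem halfRoot_sub {m k : ℕ} (hm : 0 < m) (hk : k ≤ m) :
    halfRoot m (m - k) = -(starRingEnd ℂ) (halfRoot m k) := by
  have hm' : (m : ℝ) ≠ 0 := by positivity
  have : Real.pi * ((m - k : ℕ) : ℝ) / m = Real.pi - Real.pi * k / m := by
    rw [Nat.cast_sub hk]; field_simp
  rw [halfRoot_eq, halfRoot_eq, this, Real.cos_pi_sub, Real.sin_pi_sub]
  simp [-Complex.ofReal_cos, -Complex.ofReal_sin, add_comm]

theorem node_sub {m k : ℕ} (hm : 0 < m) (hk : k ≤ m) (h : ℝ) :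
    node m h (m - k) = (starRingEnd ℂ) (node m h k) := by
  simp [node, halfRoot_sub hm hk, ← Complex.cosh_conj, Complex.conj_ofNat]

theorem weight_sub {m k : ℕ} (hm : 0 < m) (hk : k ≤ m) (h : ℝ) :
    weight m h (m - k) = (starRingEnd ℂ) (weight m h k) := by
  simp [weight, halfRoot_sub hm hk, ← Complex.sinh_conj]

section trig

variable (m : ℕ) (h : ℝ) (k : ℕ)

theorem cosh_mul_halfRoot : Complex.cosh (h * halfRoot m k) =
    (Real.cosh (h * Real.cos (Real.pi * k / m)) * Real.cos (h * Real.sin (Real.pi * k / m)) : ℝ) +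
    (Real.sinh (h * Real.cos (Real.pi * k / m)) * Real.sin (h * Real.sin (Real.pi * k / m)) : ℝ) *
      Complex.I := by
  rw [halfRoot_eq, mul_add, ← mul_assoc, ← Complex.ofReal_mul, ← Complex.ofReal_mul,
    Complex.cosh_add, Complex.cosh_mul_I, Complex.sinh_mul_I]
  push_cast
  ring

theorem sinh_mul_halfRoot : Complex.sinh (h * halfRoot m k) =
    (Real.sinh (h * Real.cos (Real.pi * k / m)) * Real.cos (h * Real.sin (Real.pi * k / m)) : ℝ) +
    (Real.cosh (h * Real.cos (Real.pi * k / m)) * Real.sin (h * Real.sin (Real.pi * k / m)) : ℝ) *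
      Complex.I := by
  rw [halfRoot_eq, mul_add, ← mul_assoc, ← Complex.ofReal_mul, ← Complex.ofReal_mul,
    Complex.sinh_add, Complex.cosh_mul_I, Complex.sinh_mul_I]
  push_cast
  ring

theorem b₁_eq : (b₁ m h k : ℂ) = -(node m h k + (starRingEnd ℂ) (node m h k)) := by
  rw [Complex.add_conj, node, cosh_mul_halfRoot, b₁, ← Complex.ofReal_neg]
  congr 1
  simp [-Complex.ofReal_cos, -Complex.ofReal_sin, -Complex.ofReal_cosh, -Complex.ofReal_sinh]
  ring

theorem b₂_eq : (b₂ m h k : ℂ) = 2 + node m h k * (starRingEnd ℂ) (node m h k) := by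
  rw [Complex.mul_conj, node, cosh_mul_halfRoot, b₂]
  rw [← Complex.ofReal_ofNat, ← Complex.ofReal_add]
  congr 1
  rw [Complex.ofReal_ofNat, mul_assoc 2 h, mul_assoc 2 h, Real.cos_two_mul, Real.cosh_two_mul,
    Complex.normSq_mul, Complex.normSq_add_mul_I]
  generalize h * Real.sin (Real.pi * k / m) = y
  generalize h * Real.cos (Real.pi * k / m) = x
  have h1 := Real.sin_sq y
  have h2 := Real.cosh_sq x
  simp [Complex.normSq_ofNat]
  linear_combination (-4 * Real.sinh x ^ 2) * h1 + (2 - 4 * Real.cos y ^ 2) * h2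

theorem a₁_eq : (a₁ m h k : ℂ) = weight m h k + (starRingEnd ℂ) (weight m h k) := by
  rw [Complex.add_conj, weight, sinh_mul_halfRoot, a₁]
  congr 1
  rw [halfRoot_eq]
  simp [-Complex.ofReal_cos, -Complex.ofReal_sin, -Complex.ofReal_cosh, -Complex.ofReal_sinh]
  ring

theorem a₂_eq : (a₂ m h k : ℂ) = -(weight m h k * (starRingEnd ℂ) (node m h k) +
    (starRingEnd ℂ) (weight m h k) * node m h k) := by
  have : (starRingEnd ℂ) (weight m h k) * node m h k =
      (starRingEnd ℂ) (weight m h k * (starRingEnd ℂ) (node m h k)) := by simp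
  rw [this, Complex.add_conj, weight, node, sinh_mul_halfRoot, cosh_mul_halfRoot, a₂,
    ← Complex.ofReal_neg]
  congr 1
  rw [halfRoot_eq, mul_assoc 2 h, mul_assoc 2 h, Real.sin_two_mul, Real.sinh_two_mul]
  generalize h * Real.sin (Real.pi * k / m) = y
  generalize h * Real.cos (Real.pi * k / m) = x
  have h1 := Real.sin_sq y
  have h2 := Real.cosh_sq x
  simp [-Complex.ofReal_cos, -Complex.ofReal_sin, -Complex.ofReal_cosh, -Complex.ofReal_sinh]
  linear_combination (-2 * Real.cos (Real.pi * k / m) * Real.sinh x * Real.cosh x) * h1 +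
    (2 * Real.sin (Real.pi * k / m) * Real.sin y * Real.cos y) * h2

end trig

/-! ### Reduction of `B` and `P` to polynomials in z + 1/z -/

theorem prod_range_odd {M : Type*} [CommMonoid M] {m : ℕ} (hm : Odd m) (f : ℕ → M) :
    ∏ n ∈ Finset.range m, f n = f 0 * ∏ k ∈ idx m, (f k * f (m - k)) := by
  -- Oddness leaves k ↦ m − k without a fixed point on 1, …, m − 1, so 0 is the only unpaired index.
  obtain ⟨r, rfl⟩ := hm
  have h1 : idx (2 * r + 1) = Finset.Ico 1 (r + 1) := by
    ext; simp [idx]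
  rw [h1, Finset.prod_mul_distrib, Finset.prod_Ico_reflect f 1 (by omega : r + 1 ≤ 2 * r + 1 + 1),
    Finset.range_eq_Ico, Finset.prod_eq_prod_Ico_succ_bot (by omega),
    ← Finset.prod_Ico_consecutive f (by omega : 0 + 1 ≤ r + 1) (by omega : r + 1 ≤ 2 * r + 1)]
  congr 3
  ext; simp; omega

theorem sum_range_odd {M : Type*} [AddCommMonoid M] {m : ℕ} (hm : Odd m) (f : ℕ → M) :
    ∑ n ∈ Finset.range m, f n = f 0 + ∑ k ∈ idx m, (f k + f (m - k)) :=
  prod_range_odd (M := Multiplicative M) hm f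

theorem le_of_mem_idx {m k : ℕ} (hk : k ∈ idx m) : k ≤ m := by
  simp [idx] at hk; omega

theorem zero_notMem_idx (m : ℕ) : 0 ∉ idx m := by simp [idx]

/-- The derivative at `0` of a product of linear polynomials. -/
theorem eval_derivative_prod_linear {R ι : Type*} [CommRing R] [DecidableEq ι] (s : Finset ι)
    (f : ι → R[X]) : (derivative (∏ i ∈ s, f i)).eval 0 =
      ∑ i ∈ s, (derivative (f i)).eval 0 * ∏ j ∈ s.erase i, (f j).eval 0 := by
  rw [derivative_prod_finset, eval_finsetSum]
  simp [eval_prod, mul_comm]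

theorem aeval_quad_eq (m : ℕ) (h : ℝ) (z : ℂ) :
    aeval z (quad h) = z ^ 2 - node m h 0 * z + 1 := by
  simp [quad, node_zero]

theorem aeval_quartic_eq {m k : ℕ} (hm : 0 < m) (hk : k ≤ m) (h : ℝ) (z : ℂ) :
    aeval z (quartic m h k) =
      (z ^ 2 - node m h k * z + 1) * (z ^ 2 - node m h (m - k) * z + 1) := by
  simp [quartic, b₁_eq, b₂_eq, node_sub hm hk]
  ring

theorem aeval_quad_mul_B {m : ℕ} (hm : Odd m) (h : ℝ) (z : ℂ) :
    aeval z (quad h) * aeval z (B m h) =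
      ∏ n ∈ Finset.range m, (z ^ 2 - node m h n * z + 1) := by
  rw [prod_range_odd hm, aeval_quad_eq m, B, map_prod]
  congr 1
  exact Finset.prod_congr rfl fun k hk => aeval_quartic_eq hm.pos (le_of_mem_idx hk) h z

/-- Both sides are the derivative at 0 of one product of the linear polynomials q_n + weight_n X,
where q_n = z² − c_n z + 1. Differentiating factor by factor gives the right side; grouping the
factors n and m − n first gives the quartics and the numerators of `P`. -/
theorem aeval_P {m : ℕ} (hm : Odd m) (h : ℝ) (z : ℂ) :
    aeval z (P m h) = ∑ n ∈ Finset.range m, weight m h n *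
      ∏ j ∈ (Finset.range m).erase n, (z ^ 2 - node m h j * z + 1) := by
  obtain ⟨f, hf0, hf1⟩ : ∃ f : ℕ → ℂ[X], (∀ n, (f n).eval 0 = z ^ 2 - node m h n * z + 1) ∧
      ∀ n, (derivative (f n)).eval 0 = weight m h n :=
    ⟨fun n => C (z ^ 2 - node m h n * z + 1) + C (weight m h n) * X,
      fun n => by simp only [eval_add, eval_mul, eval_C, eval_X, mul_zero, add_zero],
      fun n => by
        rw [derivative_add, derivative_C, derivative_C_mul, derivative_X]
        simp⟩
  have h0 : ∀ k ∈ idx m, k ≠ 0 := by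
    rintro k hk rfl
    exact zero_notMem_idx m hk
  have hL := eval_derivative_prod_linear (Finset.range m) f
  set g : ℕ → ℂ[X] := fun k => if k = 0 then f 0 else f k * f (m - k) with hg
  have hR := eval_derivative_prod_linear (insert 0 (idx m)) g
  have hg0 : g 0 = f 0 := if_pos rfl
  have hgk : ∀ k ∈ idx m, g k = f k * f (m - k) := fun k hk => if_neg (h0 k hk)
  have hprod : ∏ n ∈ Finset.range m, f n = ∏ k ∈ insert 0 (idx m), g k := by
    rw [Finset.prod_insert (zero_notMem_idx m), prod_range_odd hm, hg0, Finset.prod_congr rfl hgk]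
  simp only [← hprod, hL, hf0, hf1] at hR
  have hq : ∀ k ∈ idx m, eval 0 (g k) = aeval z (quartic m h k) := by
    intro k hk
    rw [hgk k hk, aeval_quartic_eq hm.pos (le_of_mem_idx hk), eval_mul, hf0, hf0]
  have hd : ∀ k ∈ idx m, eval 0 (derivative (g k)) =
      aeval z (C (a₁ m h k) * X ^ 2 + C (a₂ m h k) * X + C (a₁ m h k) : ℝ[X]) := by
    intro k hk
    rw [hgk k hk, derivative_mul, eval_add, eval_mul, eval_mul, hf0, hf0, hf1, hf1]
    simp [a₁_eq, a₂_eq, weight_sub hm.pos (le_of_mem_idx hk),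
      node_sub hm.pos (le_of_mem_idx hk)]
    ring
  rw [hR, Finset.sum_insert (zero_notMem_idx m), Finset.erase_insert (zero_notMem_idx m),
    Finset.prod_congr rfl hq, hg0, hf1, weight_zero]
  simp only [P, map_add (aeval z), map_mul (aeval z), map_sum, map_prod, B, aeval_C]
  congr 1
  rw [Finset.mul_sum]
  refine Finset.sum_congr rfl fun k hk => ?_
  have he : (insert 0 (idx m)).erase k = insert 0 ((idx m).erase k) :=
    Finset.erase_insert_of_ne (h0 k hk).symm
  rw [he, Finset.prod_insert (fun h => zero_notMem_idx m (Finset.mem_of_mem_erase h)),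
    Finset.prod_congr rfl (fun j hj => hq j (Finset.mem_of_mem_erase hj)), hd k hk,
    aeval_quad_eq m, hg0, hf0]
  simp only [map_add (aeval z), map_mul (aeval z), aeval_C]
  ring

theorem sq_sub_mul_add_one {z : ℂ} (hz : z ≠ 0) (c : ℂ) :
    z ^ 2 - c * z + 1 = z * (z + z⁻¹ - c) := by
  field_simp
  ring

theorem aeval_quad_mul_B_eq_nodePoly {m : ℕ} (hm : Odd m) (h : ℝ) {z : ℂ} (hz : z ≠ 0) :
    aeval z (quad h) * aeval z (B m h) = z ^ m * (nodePoly m h).eval (z + z⁻¹) := by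
  rw [aeval_quad_mul_B hm, nodePoly, eval_prod]
  simp [sq_sub_mul_add_one hz, Finset.prod_mul_distrib]

theorem aeval_P_eq_numPoly {m : ℕ} (hm : Odd m) (h : ℝ) {z : ℂ} (hz : z ≠ 0) :
    aeval z (P m h) = z ^ (m - 1) * (numPoly m h).eval (z + z⁻¹) := by
  rw [aeval_P hm, numPoly, eval_finsetSum, Finset.mul_sum]
  refine Finset.sum_congr rfl fun n hn => ?_
  simp [sq_sub_mul_add_one hz, Finset.prod_mul_distrib, Finset.card_erase_of_mem hn, eval_prod]
  ring

theorem K_eq {m : ℕ} (hm : Odd m) (h : ℝ) :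
    (K m h : ℂ) = ∑ n ∈ Finset.range m, weight m h n := by
  rw [sum_range_odd hm, weight_zero, K, add_comm]
  push_cast
  congr 1
  exact Finset.sum_congr rfl fun k hk => by
    rw [a₁_eq, weight_sub hm.pos (le_of_mem_idx hk)]

theorem M₁_eq {m : ℕ} (hm : Odd m) (h : ℝ) :
    (M₁ m h : ℂ) = -∑ n ∈ Finset.range m, node m h n := by
  rw [sum_range_odd hm, node_zero, M₁, neg_add, ← Finset.sum_neg_distrib]
  push_cast
  rw [Finset.sum_congr rfl fun k hk => by rw [b₁_eq, ← node_sub hm.pos (le_of_mem_idx hk)]]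
  ring

theorem K₁_eq {m : ℕ} (hm : Odd m) (h : ℝ) :
    (K₁ m h : ℂ) = -∑ n ∈ Finset.range m,
      weight m h n * ∑ j ∈ (Finset.range m).erase n, node m h j := by
  have hR : ∀ n ∈ Finset.range m, weight m h n * ∑ j ∈ (Finset.range m).erase n, node m h j =
      weight m h n * -M₁ m h - weight m h n * node m h n := by
    intro n hn
    rw [Finset.sum_erase_eq_sub hn, M₁_eq hm]
    ring
  have hL : (K₁ m h : ℂ) = ∑ k ∈ idx m, ((b₁ m h k * Real.sinh h + a₂ m h k : ℂ) +
      a₁ m h k * (M₁ m h - b₁ m h k)) := by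
    rw [K₁, Complex.ofReal_sum]
    refine Finset.sum_congr rfl fun k hk => ?_
    rw [Finset.sum_erase_eq_sub hk, M₁]
    push_cast
    ring
  rw [Finset.sum_congr rfl hR, Finset.sum_sub_distrib, ← Finset.sum_mul, ← K_eq hm, hL, K,
    sum_range_odd hm, weight_zero, node_zero]
  have : ∀ k ∈ idx m, weight m h k * node m h k + weight m h (m - k) * node m h (m - k) =
      a₂ m h k - a₁ m h k * b₁ m h k := by
    intro k hk
    rw [weight_sub hm.pos (le_of_mem_idx hk), node_sub hm.pos (le_of_mem_idx hk), a₁_eq, a₂_eq,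
      b₁_eq]
    ring
  rw [Finset.sum_congr rfl this]
  simp only [Finset.sum_add_distrib, Finset.sum_sub_distrib, mul_sub, ← Finset.sum_mul]
  have hM : (M₁ m h : ℂ) = ∑ k ∈ idx m, (b₁ m h k : ℂ) - 2 * Real.cosh h := by
    rw [M₁]; push_cast; ring
  push_cast at hM ⊢
  linear_combination (-Complex.sinh h) * hM

/-! ### The fundamental solution as a sum over roots of unity -/

theorem G_eq {m : ℕ} (hm : Odd m) (x : ℝ) :
    ((G m x : ℝ) : ℂ) = Real.sign x / (2 * m) *
      ∑ n ∈ Finset.range m, halfRoot m n * Complex.sinh (x * halfRoot m n) := by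
  have hterm : ∀ n : ℕ, ((Real.exp (x * Real.cos (Real.pi * n / m)) *
      Real.cos (x * Real.sin (Real.pi * n / m) + Real.pi * n / m) : ℝ) : ℂ) =
      (halfRoot m n * Complex.exp (x * halfRoot m n) +
        (starRingEnd ℂ) (halfRoot m n * Complex.exp (x * halfRoot m n))) / 2 := by
    intro n
    rw [Complex.add_conj]
    have : halfRoot m n * Complex.exp (x * halfRoot m n) =
        Complex.exp ((x * Real.cos (Real.pi * n / m) : ℝ) +
          (x * Real.sin (Real.pi * n / m) + Real.pi * n / m : ℝ) * Complex.I) := by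
      rw [show halfRoot m n * Complex.exp (x * halfRoot m n) =
          Complex.exp ((Real.pi * n / m : ℝ) * Complex.I) * Complex.exp (x * halfRoot m n) from rfl,
        ← Complex.exp_add, halfRoot_eq]
      congr 1
      push_cast
      ring
    rw [this, Complex.exp_re]
    simp [-Complex.ofReal_cos, -Complex.ofReal_sin, -Complex.ofReal_mul, -Complex.ofReal_add,
      -Complex.ofReal_div]
    push_cast
    ring
  -- A real part is half the sum of a term and its conjugate. The conjugates, reindexed by n ↦ m −
  -- n, supply the −w e^{−xw} halves of the hyperbolic sines.
  have hconj : ∀ n ∈ Finset.Ico 1 m,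
      (starRingEnd ℂ) (halfRoot m n * Complex.exp (x * halfRoot m n)) =
        -(halfRoot m (m - n) * Complex.exp (-(x * halfRoot m (m - n)))) := by
    intro n hn
    rw [halfRoot_sub hm.pos (Finset.mem_Ico.1 hn).2.le]
    simp [← Complex.exp_conj]
  have hIcc : Finset.Icc 1 (m - 1) = Finset.Ico 1 m := by
    ext; simp; have := hm.pos; omega
  have hrefl := Finset.sum_Ico_reflect
    (fun n => -(halfRoot m n * Complex.exp (-(x * halfRoot m n)))) 1 (Nat.le_succ m)
  rw [show m + 1 - m = 1 by omega, Nat.add_sub_cancel] at hrefl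
  rw [G, hIcc, Complex.ofReal_mul, Complex.ofReal_add, Complex.ofReal_sum,
    Finset.sum_congr rfl fun n _ => hterm n, ← Finset.sum_div, Finset.sum_add_distrib,
    Finset.sum_congr rfl hconj, hrefl, ← Finset.sum_add_distrib, Finset.sum_div,
    Finset.range_eq_Ico, Finset.sum_eq_sum_Ico_succ_bot hm.pos, halfRoot_zero]
  push_cast
  congr 2
  · simp
  · refine Finset.sum_congr rfl fun n _ => ?_
    rw [Complex.sinh]
    ring

/-! ### Convolutions and polynomials in the neighbour-sum operator -/

/-- The operator `f ↦ f (· + 1) + f (· - 1)` on two-sided sequences. -/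
def neighborSum : Module.End ℂ (ℤ → ℂ) where
  toFun f β := f (β + 1) + f (β - 1)
  map_add' f g := by ext β; simp; ring
  map_smul' a f := by ext β; simp; ring

theorem neighborSum_apply (f : ℤ → ℂ) (β : ℤ) : neighborSum f β = f (β + 1) + f (β - 1) := rfl

namespace HasConvolution

variable {f f' g g' s s' : ℤ → ℂ}

theorem unique (h : HasConvolution f g s) (h' : HasConvolution f g s') : s = s' :=
  funext fun β => (h β).unique (h' β)

theorem add_left (h : HasConvolution f g s) (h' : HasConvolution f' g s') :
    HasConvolution (f + f') g (s + s') := fun β => by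
  simpa [add_mul] using (h β).add (h' β)

theorem add_right (h : HasConvolution f g s) (h' : HasConvolution f g' s') :
    HasConvolution f (g + g') (s + s') := fun β => by
  simpa [mul_add] using (h β).add (h' β)

theorem smul_left (a : ℂ) (h : HasConvolution f g s) : HasConvolution (a • f) g (a • s) :=
  fun β => by simpa [mul_assoc] using (h β).mul_left a

theorem smul_right (a : ℂ) (h : HasConvolution f g s) : HasConvolution f (a • g) (a • s) :=
  fun β => by simpa [mul_left_comm] using (h β).mul_left a

theorem sub_left (h : HasConvolution f g s) (h' : HasConvolution f' g s') :
    HasConvolution (f - f') g (s - s') := fun β => by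
  simpa [sub_mul] using (h β).sub (h' β)

theorem neighborSum_left (h : HasConvolution f g s) :
    HasConvolution (neighborSum f) g (neighborSum s) := fun β => by
  have h1 := (Equiv.addRight (1 : ℤ)).hasSum_iff.2 (h (β + 1))
  have h2 := (Equiv.addRight (-1 : ℤ)).hasSum_iff.2 (h (β - 1))
  have h3 := h1.add h2
  rw [neighborSum_apply]
  convert h3 using 1
  ext γ
  simp only [neighborSum_apply, Function.comp, Equiv.coe_addRight]
  rw [show β + 1 - (γ + 1) = β - γ by ring, show β - 1 - (γ + -1) = β - γ by ring]
  ring_nf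

theorem neighborSum_right (h : HasConvolution f g s) :
    HasConvolution f (neighborSum g) (neighborSum s) := fun β => by
  rw [neighborSum_apply]
  convert (h (β + 1)).add (h (β - 1)) using 1
  ext γ
  rw [neighborSum_apply, show β + 1 - γ = β - γ + 1 by ring, show β - 1 - γ = β - γ - 1 by ring]
  ring

/-- Translations commute with convolution, hence so does every polynomial in `neighborSum`;
existence of the original convolution is enough. -/
theorem aeval_left (p : ℂ[X]) (h : HasConvolution f g s) :
    HasConvolution (aeval neighborSum p f) g (aeval neighborSum p s) := by
  induction p using Polynomial.induction_on with
  | C a => simpa [Algebra.algebraMap_eq_smul_one] using h.smul_left a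
  | add p q hp hq => simpa using hp.add_left hq
  | monomial n a ih =>
    rw [pow_succ, ← mul_assoc, mul_comm _ X, map_mul, aeval_X]
    exact ih.neighborSum_left

theorem aeval_right (p : ℂ[X]) (h : HasConvolution f g s) :
    HasConvolution f (aeval neighborSum p g) (aeval neighborSum p s) := by
  induction p using Polynomial.induction_on with
  | C a => simpa [Algebra.algebraMap_eq_smul_one] using h.smul_right a
  | add p q hp hq => simpa using hp.add_right hq
  | monomial n a ih =>
    rw [pow_succ, ← mul_assoc, mul_comm _ X, map_mul, aeval_X]
    exact ih.neighborSum_right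

theorem delta_left (g : ℤ → ℂ) : HasConvolution discreteDelta g g := fun β => by
  convert hasSum_single (f := fun γ : ℤ => discreteDelta γ * g (β - γ)) 0 ?_ using 1
  · simp [discreteDelta]
  · intro γ hγ
    simp [discreteDelta, hγ]

theorem delta_right (f : ℤ → ℂ) : HasConvolution f discreteDelta f := fun β => by
  convert hasSum_single (f := fun γ : ℤ => f γ * discreteDelta (β - γ)) β ?_ using 1
  · simp [discreteDelta]
  · intro γ hγ
    simp [discreteDelta, sub_eq_zero, hγ.symm]

end HasConvolution

/-! ### Sequences annihilated by first-order factors away from 0 -/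

/-- The sequence `λ ^ |β|`. -/
def powSeq (z : ℂ) (β : ℤ) : ℂ := z ^ β.natAbs

/-- The sequence `sinh (a |β|)`. -/
def sinhSeq (a : ℂ) (β : ℤ) : ℂ := Complex.sinh (a * β.natAbs)

theorem eq_smul_delta_of_even {f : ℤ → ℂ} (c : ℂ) (heven : ∀ β, f (-β) = f β) (h0 : f 0 = c)
    (hs : ∀ n : ℕ, f (n + 1) = 0) : f = c • discreteDelta := by
  ext β
  rcases lt_trichotomy β 0 with hβ | rfl | hβ
  · obtain ⟨n, hn⟩ := Int.eq_ofNat_of_zero_le (show 0 ≤ -β - 1 by omega)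
    rw [← heven, show -β = (n : ℤ) + 1 by omega, hs]
    simp [discreteDelta, hβ.ne]
  · simp [discreteDelta, h0]
  · obtain ⟨n, hn⟩ := Int.eq_ofNat_of_zero_le (show 0 ≤ β - 1 by omega)
    rw [show β = (n : ℤ) + 1 by omega, hs]
    have : (n : ℤ) + 1 ≠ 0 := by omega
    simp [discreteDelta, this]

theorem neighborSum_sub_even {f : ℤ → ℂ} (heven : ∀ β, f (-β) = f β) (c : ℂ) (β : ℤ) :
    (neighborSum f - c • f) (-β) = (neighborSum f - c • f) β := by
  simp only [Pi.sub_apply, Pi.smul_apply, neighborSum_apply]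
  rw [heven, show -β + 1 = -(β - 1) by ring, show -β - 1 = -(β + 1) by ring, heven, heven]
  ring

theorem aeval_X_sub_C_apply (c : ℂ) (f : ℤ → ℂ) :
    aeval neighborSum (X - C c) f = neighborSum f - c • f := by
  simp [Algebra.algebraMap_eq_smul_one]

/-- Away from 0 both z^β and z^(−β) satisfy the recurrence; the kink of |β| at 0 leaves a multiple
of δ. The same mechanism drives `aeval_sinhSeq`. -/
theorem aeval_powSeq {z : ℂ} (hz : z ≠ 0) :
    aeval neighborSum (X - C (z + z⁻¹)) (powSeq z) = (z - z⁻¹) • discreteDelta := by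
  rw [aeval_X_sub_C_apply]
  refine eq_smul_delta_of_even _ (neighborSum_sub_even (by simp [powSeq]) _) ?_ fun n => ?_
  · simp [powSeq, neighborSum_apply]
  · have h1 : ((n : ℤ) + 1 + 1).natAbs = n + 2 := by omega
    have h2 : ((n : ℤ) + 1).natAbs = n + 1 := by omega
    simp [powSeq, neighborSum_apply, h1, h2]
    field_simp
    ring

theorem aeval_sinhSeq (a : ℂ) :
    aeval neighborSum (X - C (2 * Complex.cosh a)) (sinhSeq a) =
      (2 * Complex.sinh a) • discreteDelta := by
  rw [aeval_X_sub_C_apply]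
  refine eq_smul_delta_of_even _ (neighborSum_sub_even (by simp [sinhSeq]) _) ?_ fun n => ?_
  · simp [sinhSeq, neighborSum_apply]
    ring
  · have h1 : ((n : ℤ) + 1 + 1).natAbs = n + 2 := by omega
    have h2 : ((n : ℤ) + 1).natAbs = n + 1 := by omega
    simp [sinhSeq, neighborSum_apply, h1, h2]
    rw [show a * (n + 2) = a * (n + 1) + a by ring, show a * n = a * (n + 1) - a by ring,
      Complex.sinh_add, Complex.sinh_sub]
    ring

/-- The values of `G_m` on the grid `h ℤ`. -/
def gridG (m : ℕ) (h : ℝ) (β : ℤ) : ℂ := ((G m (h * β) : ℝ) : ℂ)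

theorem gridG_eq {m : ℕ} (hm : Odd m) {h : ℝ} (hh : 0 < h) :
    gridG m h = (1 / (2 * m) : ℂ) •
      ∑ n ∈ Finset.range m, halfRoot m n • sinhSeq (h * halfRoot m n) := by
  ext β
  rw [gridG, G_eq hm, Pi.smul_apply, Finset.sum_apply, smul_eq_mul, div_mul_eq_mul_div,
    div_mul_eq_mul_div, one_mul]
  congr 1
  rw [Finset.mul_sum]
  refine Finset.sum_congr rfl fun n _ => ?_
  simp only [Pi.smul_apply, sinhSeq, smul_eq_mul, Complex.ofReal_mul]
  rcases lt_trichotomy β 0 with hβ | rfl | hβ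
  · rw [Real.sign_of_neg (mul_neg_of_pos_of_neg hh (by exact_mod_cast hβ)),
      show ((β.natAbs : ℕ) : ℂ) = -(β : ℂ) by
        rw [← Int.cast_natCast, Int.ofNat_natAbs_of_nonpos hβ.le]; simp]
    rw [show (h : ℂ) * halfRoot m n * -(β : ℂ) = -(h * (β : ℝ) * halfRoot m n) by push_cast; ring,
      Complex.sinh_neg]
    push_cast
    ring
  · simp
  · rw [Real.sign_of_pos (mul_pos hh (by exact_mod_cast hβ)),
      show ((β.natAbs : ℕ) : ℂ) = (β : ℂ) by
        rw [← Int.cast_natCast, Int.natAbs_of_nonneg hβ.le]]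
    push_cast
    ring_nf

/-- In the n-th summand of G the factor X − c_n turns the sinh sequence into a multiple of δ, and
the other factors form the n-th product in `numPoly`. -/
theorem aeval_nodePoly_gridG {m : ℕ} (hm : Odd m) {h : ℝ} (hh : 0 < h) :
    (m : ℂ) • aeval neighborSum (nodePoly m h) (gridG m h) =
      aeval neighborSum (numPoly m h) discreteDelta := by
  have hm0 : (m : ℂ) ≠ 0 := by exact_mod_cast hm.pos.ne'
  rw [gridG_eq hm hh, map_smul, map_sum, numPoly, map_sum, LinearMap.sum_apply, smul_smul,
    Finset.smul_sum]
  refine Finset.sum_congr rfl fun n hn => ?_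
  rw [nodePoly, ← Finset.mul_prod_erase _ _ hn, mul_comm (X - C (node m h n)), map_mul, map_smul,
    Module.End.mul_apply, node, aeval_sinhSeq, map_smul, map_mul, aeval_C, weight]
  simp only [Algebra.algebraMap_eq_smul_one, smul_mul_assoc, one_mul, LinearMap.smul_apply,
    smul_smul]
  congr 1
  field_simp

/-! ### Growth of G and existence of convolutions -/

theorem norm_sinh_le (z : ℂ) : ‖Complex.sinh z‖ ≤ Real.exp ‖z‖ := by
  have h1 : ‖Complex.exp z‖ ≤ Real.exp ‖z‖ := Complex.norm_exp_le_exp_norm z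
  have h2 : ‖Complex.exp (-z)‖ ≤ Real.exp ‖z‖ := by
    simpa using Complex.norm_exp_le_exp_norm (-z)
  rw [Complex.sinh, norm_div, Complex.norm_ofNat]
  linarith [norm_sub_le (Complex.exp z) (Complex.exp (-z))]

theorem norm_gridG_le {m : ℕ} (hm : Odd m) {h : ℝ} (hh : 0 < h) (β : ℤ) :
    ‖gridG m h β‖ ≤ Real.exp (h * β.natAbs) := by
  have hm0 : (0 : ℝ) < m := by exact_mod_cast hm.pos
  rw [gridG_eq hm hh, Pi.smul_apply, Finset.sum_apply, norm_smul]
  have : ‖∑ n ∈ Finset.range m, (halfRoot m n • sinhSeq (h * halfRoot m n)) β‖ ≤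
      m * Real.exp (h * β.natAbs) := by
    have hc : ∑ _n ∈ Finset.range m, Real.exp (h * β.natAbs) = m * Real.exp (h * β.natAbs) := by
      simp
    rw [← hc]
    refine norm_sum_le_of_le _ fun n _ => ?_
    rw [Pi.smul_apply, norm_smul, norm_halfRoot, one_mul]
    refine (norm_sinh_le _).trans_eq ?_
    simp [norm_halfRoot, abs_of_pos hh]
  calc ‖(1 / (2 * m) : ℂ)‖ * _ ≤ 1 / (2 * m) * (m * Real.exp (h * β.natAbs)) := by
        gcongr
        simp
    _ ≤ Real.exp (h * β.natAbs) := by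
        have := Real.exp_pos (h * β.natAbs)
        field_simp
        linarith

theorem gridG_neg {m : ℕ} (hm : Odd m) {h : ℝ} (hh : 0 < h) (β : ℤ) :
    gridG m h (-β) = gridG m h β := by
  simp [gridG_eq hm hh, sinhSeq]

/-- The root w = 1 dominates: after division by e^x every other term carries e^{x(cos(πn/m) − 1)}
with a negative exponent. -/
theorem tendsto_G_atTop {m : ℕ} (hm : Odd m) :
    Filter.Tendsto (G m) Filter.atTop Filter.atTop := by
  have hm0 : (0 : ℝ) < m := by exact_mod_cast hm.pos
  have hneg : Filter.Tendsto (fun x : ℝ => Real.exp (-2 * x)) Filter.atTop (nhds 0) :=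
    Real.tendsto_exp_atBot.comp (Filter.tendsto_id.const_mul_atTop_of_neg (by norm_num))
  have hterm : ∀ n ∈ Finset.Icc 1 (m - 1), Filter.Tendsto (fun x : ℝ =>
      Real.exp (x * (Real.cos (Real.pi * n / m) - 1)) *
        Real.cos (x * Real.sin (Real.pi * n / m) + Real.pi * n / m)) Filter.atTop (nhds 0) := by
    intro n hn
    rw [Finset.mem_Icc] at hn
    have hn1 : (1 : ℝ) ≤ n := by exact_mod_cast hn.1
    have hnm : (n : ℝ) ≤ m := by exact_mod_cast (by omega : n ≤ m)
    have hcos : Real.cos (Real.pi * n / m) < 1 := by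
      rw [← Real.cos_zero]
      refine Real.cos_lt_cos_of_nonneg_of_le_pi le_rfl ?_ (by positivity)
      rw [div_le_iff₀ hm0]
      exact mul_le_mul_of_nonneg_left hnm Real.pi_pos.le
    have h1 : Filter.Tendsto (fun x : ℝ => Real.exp (x * (Real.cos (Real.pi * n / m) - 1)))
        Filter.atTop (nhds 0) :=
      Real.tendsto_exp_atBot.comp (Filter.tendsto_id.atTop_mul_const_of_neg (by linarith))
    exact h1.zero_mul_isBoundedUnder_le (Filter.isBoundedUnder_of
      ⟨1, fun x => by simpa using Real.abs_cos_le_one _⟩)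
  have hlim := (((hneg.const_sub 1).div_const 2).add (tendsto_finsetSum _ hterm)).const_mul
    (1 / (2 * (m : ℝ)))
  rw [Finset.sum_const_zero] at hlim
  refine (Real.tendsto_exp_atTop.atTop_mul_pos (C := 1 / (2 * (m : ℝ)) * ((1 - 0) / 2 + 0))
    (by positivity) hlim).congr' ?_
  filter_upwards [Filter.eventually_gt_atTop 0] with x hx
  rw [G, Real.sign_of_pos hx, Real.sinh_eq]
  have : Real.exp x * Real.exp (-2 * x) = Real.exp (-x) := by
    rw [← Real.exp_add]; ring_nf
  rw [mul_left_comm, mul_add, Finset.mul_sum, ← this]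
  congr 2
  · ring
  · refine Finset.sum_congr rfl fun n _ => ?_
    rw [← mul_assoc, ← Real.exp_add]
    ring_nf

/-- For uniqueness: |G| ≥ 1 far out on the grid, so the convergent series at β = 0 dominates f
itself. -/
theorem summable_of_hasConvolution_gridG {m : ℕ} (hm : Odd m) {h : ℝ} (hh : 0 < h)
    {f s : ℤ → ℂ} (hf : HasConvolution f (gridG m h) s) : Summable f := by
  refine Summable.of_norm_bounded_eventually (hf 0).summable.norm ?_
  have hT : ∀ᶠ n : ℤ in Filter.atTop, 1 ≤ ‖gridG m h n‖ := by
    have h1 : Filter.Tendsto (fun n : ℤ => h * (n : ℝ)) Filter.atTop Filter.atTop :=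
      tendsto_intCast_atTop_atTop.const_mul_atTop hh
    filter_upwards [((tendsto_G_atTop hm).comp h1).eventually_ge_atTop 1] with n hn
    rw [gridG, Complex.norm_real]
    exact hn.trans (le_abs_self _)
  have hB : ∀ᶠ n : ℤ in Filter.atBot, 1 ≤ ‖gridG m h n‖ := by
    filter_upwards [Filter.tendsto_neg_atBot_atTop.eventually hT] with n hn
    rwa [gridG_neg hm hh] at hn
  rw [Int.cofinite_eq, Filter.eventually_sup]
  have key : ∀ n : ℤ, 1 ≤ ‖gridG m h n‖ → ‖f n‖ ≤ ‖f n * gridG m h (0 - n)‖ := by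
    intro n hn
    rw [zero_sub, gridG_neg hm hh, norm_mul]
    exact le_mul_of_one_le_right (norm_nonneg _) hn
  exact ⟨hB.mono key, hT.mono key⟩

theorem summable_pow_natAbs {r : ℝ} (h0 : 0 ≤ r) (h1 : r < 1) :
    Summable fun γ : ℤ => r ^ γ.natAbs := by
  refine Summable.of_nat_of_neg ?_ ?_ <;> simpa using summable_geometric_of_lt_one h0 h1

theorem exists_hasConvolution {f g : ℤ → ℂ} (h : ∀ β, Summable fun γ => f γ * g (β - γ)) :
    ∃ s, HasConvolution f g s := ⟨_, fun β => (h β).hasSum⟩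

/-- Existence of a convolution with a sequence of exponential growth. -/
theorem exists_hasConvolution_of_exp {f g : ℤ → ℂ} {h : ℝ} (hh : 0 < h)
    (hf : Summable fun γ : ℤ => ‖f γ‖ * Real.exp (h * γ.natAbs))
    (hg : ∀ β : ℤ, ‖g β‖ ≤ Real.exp (h * β.natAbs)) : ∃ s, HasConvolution f g s := by
  refine exists_hasConvolution fun β => ?_
  refine Summable.of_norm_bounded (hf.mul_left (Real.exp (h * β.natAbs))) fun γ => ?_
  rw [norm_mul, mul_left_comm, ← Real.exp_add, ← mul_add]
  refine mul_le_mul_of_nonneg_left ((hg _).trans (Real.exp_le_exp.2 ?_)) (norm_nonneg _)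
  refine mul_le_mul_of_nonneg_left ?_ hh.le
  exact_mod_cast Int.natAbs_sub_le β γ

theorem exists_hasConvolution_of_bounded {f g : ℤ → ℂ} (hf : Summable f) {M : ℝ}
    (hg : ∀ β : ℤ, ‖g β‖ ≤ M) : ∃ s, HasConvolution f g s := by
  refine exists_hasConvolution fun β => ?_
  refine Summable.of_norm_bounded (hf.norm.mul_right M) fun γ => ?_
  rw [norm_mul]
  exact mul_le_mul_of_nonneg_left (hg _) (norm_nonneg _)

/-! ### Inverting a sequence with rational symbol -/

/-- An abstract criterion for the inverse of a sequence with rational symbol. -/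
theorem hasConvolution_delta_iff {g d : ℤ → ℂ} {h : ℝ} (hh : 0 < h) {p q : ℂ[X]}
    (hpq : IsCoprime p q) (hg : ∀ β : ℤ, ‖g β‖ ≤ Real.exp (h * β.natAbs))
    (hgsum : ∀ f s : ℤ → ℂ, HasConvolution f g s → Summable f)
    (hd : Summable fun γ : ℤ => ‖d γ‖ * Real.exp (h * γ.natAbs))
    (hgq : aeval neighborSum q g = aeval neighborSum p discreteDelta)
    (hdp : aeval neighborSum p d = aeval neighborSum q discreteDelta) (f : ℤ → ℂ) :
    HasConvolution f g discreteDelta ↔ f = d := by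
  -- The Bézout identity: a sequence killed by two coprime polynomials in T vanishes.
  have hker : ∀ s : ℤ → ℂ, aeval neighborSum p s = 0 → aeval neighborSum q s = 0 → s = 0 := by
    intro s hp hq
    obtain ⟨a, b, hab⟩ := hpq
    have := congrArg (fun r => aeval neighborSum r s) hab
    simpa [hp, hq] using this.symm
  have hdelta : HasConvolution d g discreteDelta := by
    obtain ⟨s, hs⟩ := exists_hasConvolution_of_exp hh hd hg
    -- With s = d * g: p(T)s = (q(T)δ) * g = q(T)g = p(T)δ and q(T)s = d * (p(T)δ) = p(T)d = q(T)δ,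
    -- so s − δ lies in both kernels.
    have hp := hs.aeval_left p
    rw [hdp] at hp
    have hp' := (HasConvolution.delta_left g).aeval_left q
    rw [hgq] at hp'
    have hq := hs.aeval_right q
    rw [hgq] at hq
    have hq' := (HasConvolution.delta_right d).aeval_right p
    rw [hdp] at hq'
    have : s - discreteDelta = 0 := hker _ (by rw [map_sub, hp.unique hp', sub_self])
      (by rw [map_sub, hq.unique hq', sub_self])
    rwa [← sub_eq_zero.1 this]
  refine ⟨fun hf => ?_, fun hf => hf ▸ hdelta⟩
  have he := hf.sub_left hdelta
  rw [sub_self] at he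
  -- For e = f − d, applying q(T) to e * g = 0 gives p(T)e = 0. Then q(T)e = e * (p(T)d) = (p(T)e) *
  -- d = 0; the convolution e * d exists because e is summable and d is bounded.
  have hp : aeval neighborSum p (f - d) = 0 := by
    have h1 := he.aeval_right q
    rw [hgq, map_zero] at h1
    exact ((HasConvolution.delta_right (f - d)).aeval_right p).unique h1
  have hbd : ∀ β : ℤ, ‖d β‖ ≤ ∑' γ : ℤ, ‖d γ‖ * Real.exp (h * γ.natAbs) := fun β =>
    (le_mul_of_one_le_right (norm_nonneg _) (Real.one_le_exp (by positivity))).trans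
      (hd.le_tsum β fun _ _ => by positivity)
  obtain ⟨s, hs⟩ := exists_hasConvolution_of_bounded (hgsum _ _ he) hbd
  have h1 := hs.aeval_left p
  rw [hp] at h1
  have h2 := hs.aeval_right p
  rw [hdp] at h2
  have h0 : HasConvolution 0 d 0 := fun β => by simp [hasSum_zero]
  have hq : aeval neighborSum q (f - d) = 0 := by
    rw [((HasConvolution.delta_right (f - d)).aeval_right q).unique h2, h1.unique h0]
  exact sub_eq_zero.1 (hker _ hp hq)

/-! ### Leading coefficients and partial fractions of N/R -/

theorem degree_mul_X_sub_C_lt {R : Type*} [CommRing R] {r : R[X]} {k : ℕ} (hr : r.degree < k)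
    (c : R) : ((X - C c) * r).degree < ((k + 1 : ℕ) : WithBot ℕ) := by
  rw [degree_lt_iff_coeff_zero] at hr ⊢
  intro n hn
  obtain ⟨n, rfl⟩ : ∃ l, n = l + 1 := ⟨n - 1, by omega⟩
  rw [sub_mul, coeff_sub, coeff_X_mul, coeff_C_mul, hr n (by omega), hr (n + 1) (by omega)]
  simp

theorem degree_lt_of_X_mul {R : Type*} [CommRing R] {r : R[X]} {k : ℕ}
    (hr : (X * r).degree < ((k + 1 : ℕ) : WithBot ℕ)) : r.degree < k := by
  rw [degree_lt_iff_coeff_zero] at hr ⊢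
  intro n hn
  rw [← coeff_X_mul]
  exact hr _ (by omega)

/-- The two leading terms of a product of monic linear factors. -/
theorem degree_X_mul_prod_sub_lt {R ι : Type*} [CommRing R] [DecidableEq ι] (s : Finset ι)
    (c : ι → R) : (X * ∏ i ∈ s, (X - C (c i)) -
      (X ^ (s.card + 1) - C (∑ i ∈ s, c i) * X ^ s.card)).degree < (s.card : WithBot ℕ) := by
  induction s using Finset.induction_on with
  | empty => simp
  | insert a s ha ih =>
    have h1 := degree_mul_X_sub_C_lt ih (c a)
    rw [Finset.card_insert_of_notMem ha, Finset.prod_insert ha, Finset.sum_insert ha]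
    have h2 : (C (c a * ∑ i ∈ s, c i) * X ^ s.card).degree < ((s.card + 1 : ℕ) : WithBot ℕ) :=
      (degree_C_mul_X_pow_le _ _).trans_lt (by exact_mod_cast Nat.lt_succ_self _)
    refine lt_of_eq_of_lt ?_ ((degree_add_le _ _).trans_lt (max_lt h1 h2))
    congr 1
    simp only [C_add, C_mul]
    ring

theorem degree_sum_lt {R ι : Type*} [CommRing R] (s : Finset ι) (f : ι → R[X]) {k : ℕ}
    (hf : ∀ i ∈ s, (f i).degree < k) : (∑ i ∈ s, f i).degree < k := by
  rw [← mem_degreeLT]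
  exact Submodule.sum_mem _ fun i hi => mem_degreeLT.2 (hf i hi)

theorem degree_C_mul_lt {R : Type*} [CommRing R] {r : R[X]} {k : ℕ} (hr : r.degree < k) (a : R) :
    (C a * r).degree < k := by
  rw [← mem_degreeLT, ← smul_eq_C_mul]
  exact Submodule.smul_mem _ _ (mem_degreeLT.2 hr)

theorem degree_sub_lt' {R : Type*} [CommRing R] {r s : R[X]} {k : ℕ} (hr : r.degree < k)
    (hs : s.degree < k) : (r - s).degree < k :=
  (degree_sub_le _ _).trans_lt (max_lt hr hs)

theorem degree_X_mul_nodePoly_sub_lt {m : ℕ} (hm : Odd m) (h : ℝ) :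
    (X * nodePoly m h - (X ^ (m + 1) + C (M₁ m h : ℂ) * X ^ m)).degree < (m : WithBot ℕ) := by
  have := degree_X_mul_prod_sub_lt (Finset.range m) (node m h)
  rw [Finset.card_range] at this
  rw [M₁_eq hm, C_neg, neg_mul, ← sub_eq_add_neg]
  exact this

/-- The extra factor X keeps the exponent of the K₁ term from being the truncated m − 2 when m = 1.
-/
theorem degree_X_mul_numPoly_sub_lt {m : ℕ} (hm : Odd m) (h : ℝ) :
    (X * numPoly m h - (C (K m h : ℂ) * X ^ m + C (K₁ m h : ℂ) * X ^ (m - 1))).degree <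
      ((m - 1 : ℕ) : WithBot ℕ) := by
  have hterm : ∀ n ∈ Finset.range m, (C (weight m h n) *
      (X * ∏ j ∈ (Finset.range m).erase n, (X - C (node m h j)) -
        (X ^ m - C (∑ j ∈ (Finset.range m).erase n, node m h j) * X ^ (m - 1)))).degree <
      ((m - 1 : ℕ) : WithBot ℕ) := by
    intro n hn
    have := degree_X_mul_prod_sub_lt ((Finset.range m).erase n) (node m h)
    rw [Finset.card_erase_of_mem hn, Finset.card_range, Nat.sub_add_cancel hm.pos] at this
    exact degree_C_mul_lt this _
  refine lt_of_eq_of_lt ?_ (degree_sum_lt _ _ hterm)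
  congr 1
  rw [numPoly, K_eq hm, K₁_eq hm]
  simp only [mul_sub, Finset.sum_sub_distrib, C_neg, map_sum, C_mul, Finset.mul_sum,
    Finset.sum_mul, neg_mul, mul_left_comm X]
  rw [sub_add_eq_sub_sub, sub_neg_eq_add]
  simp only [mul_assoc]
  ring

/-- Both sides have the same coefficient at X^(m−1) and agree at m − 1 distinct points. K ≠ 0 is not
assumed, so the factorization can later be used to prove it. -/
theorem numPoly_eq {m : ℕ} (hm : Odd m) {h : ℝ} {μ : Fin (m - 1) → ℂ}
    (hμ : Function.Injective μ) (hroot : ∀ n, (numPoly m h).eval (μ n) = 0) :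
    numPoly m h = C (K m h : ℂ) * ∏ n, (X - C (μ n)) := by
  have h1 := degree_X_mul_numPoly_sub_lt hm h
  have h2 := degree_C_mul_lt (degree_X_mul_prod_sub_lt Finset.univ μ) (K m h : ℂ)
  rw [Finset.card_univ, Fintype.card_fin, Nat.sub_add_cancel hm.pos] at h2
  have h3 := degree_sub_lt' h1 h2
  have h4 : (C (K₁ m h + K m h * ∑ n, μ n : ℂ) * X ^ (m - 1)).degree < ((m - 1 + 1 : ℕ) : WithBot ℕ) :=
    (degree_C_mul_X_pow_le _ _).trans_lt (by exact_mod_cast Nat.lt_succ_self _)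
  have h5 : (X * (numPoly m h - C (K m h : ℂ) * ∏ n, (X - C (μ n)))).degree <
      ((m - 1 + 1 : ℕ) : WithBot ℕ) := by
    refine lt_of_eq_of_lt ?_ ((degree_add_le _ _).trans_lt (max_lt (h3.trans ?_) h4))
    · congr 1
      simp only [C_add, C_mul]
      ring
    · exact_mod_cast Nat.lt_succ_self _
  refine eq_of_degree_sub_lt_of_eval_finset_eq (Finset.univ.image μ) ?_ ?_
  · rw [Finset.card_image_of_injective _ hμ, Finset.card_univ, Fintype.card_fin]
    exact degree_lt_of_X_mul h5
  · intro x hx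
    obtain ⟨n, -, rfl⟩ := Finset.mem_image.1 hx
    rw [hroot, eval_mul, eval_prod, Finset.prod_eq_zero (Finset.mem_univ n) (by simp), mul_zero]

/-- Differentiate P(z) = z^(m−1) R(z + 1/z) near z; the term containing R itself drops out at a
root. -/
theorem aeval_derivative_P {m : ℕ} (hm : Odd m) (h : ℝ) {z : ℂ} (hz : z ≠ 0)
    (hroot : (numPoly m h).eval (z + z⁻¹) = 0) :
    aeval z (derivative (P m h)) =
      z ^ (m - 1) * ((derivative (numPoly m h)).eval (z + z⁻¹) * (1 - (z ^ 2)⁻¹)) := by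
  have h1 := (P m h).hasDerivAt_aeval z
  have h2 : HasDerivAt (fun x : ℂ => x + x⁻¹) (1 - (z ^ 2)⁻¹) z := by
    rw [sub_eq_add_neg]
    exact (hasDerivAt_id z).add (hasDerivAt_inv hz)
  have h3 := ((hasDerivAt_pow (m - 1) z).mul
    (((numPoly m h).hasDerivAt (z + z⁻¹)).comp z h2))
  have h4 : (fun x => aeval x (P m h)) =ᶠ[nhds z]
      fun x => x ^ (m - 1) * (numPoly m h).eval (x + x⁻¹) := by
    filter_upwards [isOpen_ne.mem_nhds hz] with x hx
    exact aeval_P_eq_numPoly hm h hx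
  have h5 := h1.unique (h3.congr_of_eventuallyEq h4)
  rw [h5]
  simp [hroot]

theorem eval_derivative_prod_X_sub_C {R ι : Type*} [CommRing R] [Fintype ι] [DecidableEq ι]
    (μ : ι → R) (n : ι) : (derivative (∏ i, (X - C (μ i)))).eval (μ n) =
      ∏ j ∈ Finset.univ.erase n, (μ n - μ j) := by
  rw [derivative_prod_finset, eval_finsetSum, Finset.sum_eq_single n]
  · simp [eval_prod]
  · intro i _ hi
    rw [eval_mul, eval_prod, Finset.prod_eq_zero (i := n) (by simp [hi.symm]) (by simp), zero_mul]
  · simp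

theorem one_sub_inv_sq_ne_zero {z : ℂ} (hz1 : ‖z‖ < 1) : 1 - (z ^ 2)⁻¹ ≠ 0 := by
  intro h0
  have : z ^ 2 = 1 := by
    rw [sub_eq_zero] at h0
    rw [← inv_inv (z ^ 2), ← h0, inv_one]
  have h2 : ‖z‖ ^ 2 = 1 := by rw [← norm_pow, this, norm_one]
  nlinarith [norm_nonneg z]

theorem aeval_C_mul_apply (c : ℂ) (p : ℂ[X]) (f : ℤ → ℂ) :
    aeval neighborSum (C c * p) f = c • aeval neighborSum p f := by
  rw [map_mul, aeval_C, Algebra.algebraMap_eq_smul_one, smul_mul_assoc, one_mul,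
    LinearMap.smul_apply]

section roots

variable {m : ℕ} {h : ℝ} {lam : Fin (m - 1) → ℂ}

theorem eval_derivative_numPoly (hm : Odd m)
    (hinj : Function.Injective fun n => lam n + (lam n)⁻¹)
    (hroot : ∀ n, (numPoly m h).eval (lam n + (lam n)⁻¹) = 0) (n : Fin (m - 1)) :
    (derivative (numPoly m h)).eval (lam n + (lam n)⁻¹) = K m h *
      ∏ j ∈ Finset.univ.erase n, (lam n + (lam n)⁻¹ - (lam j + (lam j)⁻¹)) := by
  rw [numPoly_eq hm hinj hroot, derivative_C_mul, eval_mul, eval_C]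
  exact congrArg _ (eval_derivative_prod_X_sub_C (fun n => lam n + (lam n)⁻¹) n)

theorem aeval_derivative_P_ne_zero (hm : Odd m) (hK : K m h ≠ 0)
    (hinj : Function.Injective fun n => lam n + (lam n)⁻¹)
    (hroot : ∀ n, (numPoly m h).eval (lam n + (lam n)⁻¹) = 0) (h0 : ∀ n, lam n ≠ 0)
    (h1 : ∀ n, ‖lam n‖ < 1) (n : Fin (m - 1)) :
    aeval (lam n) (derivative (P m h)) ≠ 0 := by
  rw [aeval_derivative_P hm h (h0 n) (hroot n), eval_derivative_numPoly hm hinj hroot]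
  refine mul_ne_zero (pow_ne_zero _ (h0 n)) (mul_ne_zero (mul_ne_zero ?_ ?_)
    (one_sub_inv_sq_ne_zero (h1 n)))
  · exact_mod_cast hK
  · refine Finset.prod_ne_zero_iff.2 fun j hj => sub_ne_zero.2 fun he => ?_
    exact (Finset.ne_of_mem_erase hj) (hinj he).symm

/-- The partial fraction decomposition of `nodePoly / numPoly`, cleared of denominators. -/
theorem partial_fractions (hm : Odd m) (hK : K m h ≠ 0)
    (hinj : Function.Injective fun n => lam n + (lam n)⁻¹)
    (hroot : ∀ n, (numPoly m h).eval (lam n + (lam n)⁻¹) = 0) (h0 : ∀ n, lam n ≠ 0)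
    (h1 : ∀ n, ‖lam n‖ < 1) :
    C (K m h : ℂ) * nodePoly m h = numPoly m h * (X + C (M₁ m h - K₁ m h / K m h : ℂ)) +
      ∑ n, C (A m h (lam n) / lam n * (lam n - (lam n)⁻¹)) *
        (C (K m h : ℂ) * ∏ j ∈ Finset.univ.erase n, (X - C (lam j + (lam j)⁻¹))) := by
  have hK' : (K m h : ℂ) ≠ 0 := by exact_mod_cast hK
  rw [← sub_eq_iff_eq_add']
  have hdegS : (∑ n, C (A m h (lam n) / lam n * (lam n - (lam n)⁻¹)) *
      (C (K m h : ℂ) * ∏ j ∈ Finset.univ.erase n, (X - C (lam j + (lam j)⁻¹)))).degree <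
      ((m - 1 : ℕ) : WithBot ℕ) := by
    refine degree_sum_lt _ _ fun n hn => degree_C_mul_lt (degree_C_mul_lt ?_ _) _
    rw [degree_prod_of_monic _ _ fun i _ => monic_X_sub_C _]
    simp only [degree_X_sub_C, Finset.sum_const, Finset.card_erase_of_mem hn, Finset.card_univ,
      Fintype.card_fin, nsmul_eq_mul, mul_one]
    exact_mod_cast Nat.sub_lt (Fin.pos n) one_pos
  -- The constant M₁ − K₁/K is the one that cancels the second coefficient, leaving a remainder
  -- determined by its values at the m − 1 roots.
  have hdegQ : (C (K m h : ℂ) * nodePoly m h -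
      numPoly m h * (X + C (M₁ m h - K₁ m h / K m h : ℂ))).degree < ((m - 1 : ℕ) : WithBot ℕ) := by
    refine degree_lt_of_X_mul ?_
    have e1 := degree_C_mul_lt (degree_X_mul_nodePoly_sub_lt hm h) (K m h : ℂ)
    have e2 := degree_mul_X_sub_C_lt (degree_X_mul_numPoly_sub_lt hm h)
      (-(M₁ m h - K₁ m h / K m h : ℂ))
    have e3 : (C (K₁ m h * (M₁ m h - K₁ m h / K m h) : ℂ) * X ^ (m - 1)).degree <
        ((m - 1 + 1 : ℕ) : WithBot ℕ) :=
      (degree_C_mul_X_pow_le _ _).trans_lt (by exact_mod_cast Nat.lt_succ_self _)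
    obtain ⟨r, rfl⟩ : ∃ r, m = r + 1 := ⟨m - 1, by have := hm.pos; omega⟩
    rw [Nat.add_sub_cancel] at *
    refine lt_of_eq_of_lt ?_ (degree_sub_lt' (degree_sub_lt' e1 e2) e3)
    congr 1
    have : C (K (r + 1) h : ℂ) * C (M₁ (r + 1) h : ℂ) = C (K₁ (r + 1) h : ℂ) +
        C (K (r + 1) h : ℂ) * C (M₁ (r + 1) h - K₁ (r + 1) h / K (r + 1) h : ℂ) := by
      rw [← C_mul, ← C_mul, ← C_add]
      congr 1
      field_simp
      ring
    simp only [C_neg, C_mul]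
    linear_combination (X : ℂ[X]) ^ (r + 1) * this
  refine eq_of_degree_sub_lt_of_eval_finset_eq
    (Finset.univ.image fun n => lam n + (lam n)⁻¹) ?_ ?_
  · rw [Finset.card_image_of_injective _ hinj, Finset.card_univ, Fintype.card_fin]
    exact degree_sub_lt' hdegQ hdegS
  · intro x hx
    obtain ⟨n, -, rfl⟩ := Finset.mem_image.1 hx
    rw [eval_sub, eval_mul, eval_mul, hroot, zero_mul, sub_zero, eval_C, eval_finsetSum,
      Finset.sum_eq_single n]
    · have hP := aeval_derivative_P_ne_zero hm hK hinj hroot h0 h1 n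
      have hd := aeval_derivative_P hm h (h0 n) (hroot n)
      rw [eval_derivative_numPoly hm hinj hroot] at hd
      have hT := aeval_quad_mul_B_eq_nodePoly hm h (h0 n)
      simp only [eval_mul, eval_C, eval_prod, eval_sub, eval_X]
      -- The chain rule relates P'(λ_n) to R'(λ_n + 1/λ_n), which makes (A_n/λ_n)(λ_n − 1/λ_n) the
      -- residue N/R' at that root.
      have key : lam n ^ m * (lam n - (lam n)⁻¹) * (K m h * ∏ j ∈ Finset.univ.erase n,
          (lam n + (lam n)⁻¹ - (lam j + (lam j)⁻¹))) =
          lam n ^ 2 * aeval (lam n) (derivative (P m h)) := by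
        have e1 : lam n ^ m = lam n ^ (m - 1) * lam n := by
          rw [← pow_succ, Nat.sub_add_cancel hm.pos]
        have e2 : lam n * (lam n - (lam n)⁻¹) = lam n ^ 2 * (1 - (lam n ^ 2)⁻¹) := by
          have := h0 n
          field_simp
        rw [hd, e1]
        linear_combination (lam n ^ (m - 1) * (K m h * ∏ j ∈ Finset.univ.erase n,
          (lam n + (lam n)⁻¹ - (lam j + (lam j)⁻¹)))) * e2
      have hne : lam n ^ 2 * aeval (lam n) (derivative (P m h)) ≠ 0 :=
        mul_ne_zero (pow_ne_zero _ (h0 n)) hP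
      rw [A, hT, ← mul_div_cancel_right₀ ((K m h : ℂ) * eval _ _) hne]
      nth_rewrite 1 [← key]
      generalize ∏ j ∈ Finset.univ.erase n, (lam n + (lam n)⁻¹ - (lam j + (lam j)⁻¹)) = Q
      rw [pow_two, mul_assoc (lam n), ← div_div, ← div_div, ← div_div]
      ring
    · intro i _ hi
      rw [eval_mul, eval_mul, eval_prod, Finset.prod_eq_zero (i := n) (by simp [hi.symm]) (by simp)]
      simp
    · simp

/-- The polynomial part X + const of N/R accounts for the exceptional cases: T δ adds the 1 at |β| =
1 and the constant appears at β = 0. -/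
theorem explicitD_eq (h0 : ∀ n, lam n ≠ 0) : explicitD m h lam = ((m : ℂ) / K m h) •
    (neighborSum discreteDelta + (M₁ m h - K₁ m h / K m h : ℂ) • discreteDelta +
      ∑ n, (A m h (lam n) / lam n) • powSeq (lam n)) := by
  have hpow : ∀ k : ℕ, ∑ n, A m h (lam n) / lam n * lam n ^ (k + 1) =
      ∑ n, A m h (lam n) * lam n ^ k := fun k =>
    Finset.sum_congr rfl fun n _ => by rw [pow_succ', ← mul_assoc, div_mul_cancel₀ _ (h0 n)]
  ext β
  rw [explicitD, Pi.smul_apply, smul_eq_mul]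
  congr 1
  simp only [Pi.add_apply, Finset.sum_apply, Pi.smul_apply, smul_eq_mul, neighborSum_apply,
    discreteDelta, powSeq]
  by_cases c1 : β = 0
  · simp [c1]
  obtain ⟨k, hk⟩ : ∃ k, β.natAbs = k + 1 := ⟨β.natAbs - 1, by omega⟩
  rw [if_neg c1, if_neg c1, hk, hpow]
  by_cases c2 : k = 0
  · obtain rfl | rfl : β = 1 ∨ β = -1 := by omega
    all_goals simp [c2]
  · rw [if_neg (by omega), if_neg (by omega), if_neg (by omega)]
    simp

theorem aeval_numPoly_explicitD (hm : Odd m) (hK : K m h ≠ 0)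
    (hinj : Function.Injective fun n => lam n + (lam n)⁻¹)
    (hroot : ∀ n, (numPoly m h).eval (lam n + (lam n)⁻¹) = 0) (h0 : ∀ n, lam n ≠ 0)
    (h1 : ∀ n, ‖lam n‖ < 1) :
    aeval neighborSum (numPoly m h) (explicitD m h lam) =
      (m : ℂ) • aeval neighborSum (nodePoly m h) discreteDelta := by
  have hK' : (K m h : ℂ) ≠ 0 := by exact_mod_cast hK
  have hterm : ∀ n, aeval neighborSum (numPoly m h) (powSeq (lam n)) =
      (lam n - (lam n)⁻¹) • aeval neighborSum (C (K m h : ℂ) *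
        ∏ j ∈ Finset.univ.erase n, (X - C (lam j + (lam j)⁻¹))) discreteDelta := by
    intro n
    rw [numPoly_eq hm hinj hroot, ← Finset.prod_erase_mul _ _ (Finset.mem_univ n), ← mul_assoc,
      map_mul _ _ (X - _), Module.End.mul_apply, aeval_powSeq (h0 n), map_smul]
  have hpf := congrArg (fun p => aeval neighborSum p discreteDelta)
    (partial_fractions hm hK hinj hroot h0 h1)
  simp only [map_add (aeval neighborSum), aeval_C_mul_apply, map_sum (aeval neighborSum),
    LinearMap.add_apply, LinearMap.sum_apply] at hpf
  rw [map_mul (aeval neighborSum) (numPoly m h), Module.End.mul_apply, map_add, aeval_X, aeval_C,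
    Algebra.algebraMap_eq_smul_one, LinearMap.add_apply, LinearMap.smul_apply,
    Module.End.one_apply] at hpf
  rw [explicitD_eq h0, map_smul, map_add, map_sum]
  simp only [map_smul, hterm, aeval_C_mul_apply]
  simp only [smul_smul, mul_assoc] at hpf ⊢
  rw [← hpf, smul_smul, div_mul_cancel₀ _ hK']

theorem summable_explicitD (h0 : ∀ n, lam n ≠ 0)
    (hlam : ∀ n, ‖lam n‖ < Real.exp (-h)) :
    Summable fun γ : ℤ => ‖explicitD m h lam γ‖ * Real.exp (h * γ.natAbs) := by
  have hpow : ∀ n, Summable fun γ : ℤ => ‖powSeq (lam n) γ‖ * Real.exp (h * γ.natAbs) := by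
    intro n
    have hlt : ‖lam n‖ * Real.exp h < 1 := by
      have := mul_lt_mul_of_pos_right (hlam n) (Real.exp_pos h)
      rwa [← Real.exp_add, neg_add_cancel, Real.exp_zero] at this
    refine (summable_pow_natAbs (by positivity) hlt).congr fun γ => ?_
    rw [powSeq, norm_pow, mul_pow, ← Real.exp_nat_mul, mul_comm h]
  have hfin : Summable fun γ : ℤ => ‖(neighborSum discreteDelta +
      (M₁ m h - K₁ m h / K m h : ℂ) • discreteDelta) γ‖ * Real.exp (h * γ.natAbs) := by
    refine summable_of_ne_finset_zero (s := {-1, 0, 1}) fun γ hγ => ?_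
    simp only [Finset.mem_insert, Finset.mem_singleton, not_or] at hγ
    have e1 : γ + 1 ≠ 0 := by omega
    have e2 : γ - 1 ≠ 0 := by omega
    simp [neighborSum_apply, discreteDelta, hγ.2.1, e1, e2]
  have hsum : Summable fun γ : ℤ => ‖(m : ℂ) / K m h‖ * (‖(neighborSum discreteDelta +
      (M₁ m h - K₁ m h / K m h : ℂ) • discreteDelta) γ‖ * Real.exp (h * γ.natAbs) +
      ∑ n, ‖A m h (lam n) / lam n‖ * (‖powSeq (lam n) γ‖ * Real.exp (h * γ.natAbs))) :=
    (hfin.add (summable_sum fun n _ => (hpow n).mul_left _)).mul_left _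
  refine Summable.of_nonneg_of_le (fun γ => by positivity) (fun γ => ?_) hsum
  simp only [← mul_assoc, ← Finset.sum_mul, ← add_mul, mul_add]
  refine mul_le_mul_of_nonneg_right ?_ (Real.exp_pos _).le
  rw [explicitD_eq h0, Pi.smul_apply, norm_smul, ← mul_add]
  refine mul_le_mul_of_nonneg_left ((norm_add_le _ _).trans (add_le_add_right ?_ _))
    (norm_nonneg _)
  rw [Finset.sum_apply]
  refine norm_sum_le_of_le _ fun n _ => ?_
  rw [Pi.smul_apply, norm_smul]

/-- The roots of the quadratic are e^{±a}, of modulus at least e^{−|a|}. -/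
theorem sq_sub_two_cosh_ne_zero {z a : ℂ} (ha : ‖z‖ < Real.exp (-‖a‖)) :
    z ^ 2 - 2 * Complex.cosh a * z + 1 ≠ 0 := by
  have hne : ∀ b : ℂ, ‖b‖ = ‖a‖ → z - Complex.exp b ≠ 0 := by
    intro b hb h
    rw [sub_eq_zero.1 h, Complex.norm_exp, ← hb] at ha
    have := (abs_le.1 (Complex.abs_re_le_norm b)).1
    exact absurd ha (not_lt.2 (Real.exp_le_exp.2 this))
  have : z ^ 2 - 2 * Complex.cosh a * z + 1 = (z - Complex.exp a) * (z - Complex.exp (-a)) := by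
    have : Complex.exp a * Complex.exp (-a) = 1 := by rw [← Complex.exp_add]; simp
    rw [Complex.cosh]
    linear_combination -this
  rw [this]
  exact mul_ne_zero (hne a rfl) (hne (-a) (norm_neg a))

theorem isCoprime_numPoly_nodePoly (hm : Odd m) (hh : 0 < h) (hK : K m h ≠ 0)
    (hinj : Function.Injective fun n => lam n + (lam n)⁻¹)
    (hroot : ∀ n, (numPoly m h).eval (lam n + (lam n)⁻¹) = 0) (h0 : ∀ n, lam n ≠ 0)
    (hlam : ∀ n, ‖lam n‖ < Real.exp (-h)) :
    IsCoprime (numPoly m h) (C (m : ℂ) * nodePoly m h) := by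
  have hK' : IsUnit (C (K m h : ℂ)) := isUnit_C.2 (isUnit_iff_ne_zero.2 (by exact_mod_cast hK))
  have hm' : IsUnit (C (m : ℂ)) :=
    isUnit_C.2 (isUnit_iff_ne_zero.2 (by exact_mod_cast hm.pos.ne'))
  rw [numPoly_eq hm hinj hroot, isCoprime_mul_unit_left_left hK', isCoprime_mul_unit_left_right hm',
    nodePoly]
  refine IsCoprime.prod_left fun n _ => IsCoprime.prod_right fun j _ =>
    isCoprime_X_sub_C_of_isUnit_sub (isUnit_iff_ne_zero.2 fun he => ?_)
  refine sq_sub_two_cosh_ne_zero (z := lam n) (a := h * halfRoot m j) ?_ ?_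
  · simpa [norm_halfRoot, abs_of_pos hh] using hlam n
  · change lam n ^ 2 - node m h j * lam n + 1 = 0
    rw [sq_sub_mul_add_one (h0 n), he, mul_zero]

/-- If the reduced numerator has the expected roots, the explicit sequence is the only inverse. -/
theorem isDiscreteAnalogue_iff (hm : Odd m) (hh : 0 < h) (hK : K m h ≠ 0)
    (hinj : Function.Injective fun n => lam n + (lam n)⁻¹)
    (hroot : ∀ n, (numPoly m h).eval (lam n + (lam n)⁻¹) = 0) (h0 : ∀ n, lam n ≠ 0)
    (hlam : ∀ n, ‖lam n‖ < Real.exp (-h)) (D : ℤ → ℂ) :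
    IsDiscreteAnalogue m h D ↔ D = explicitD m h lam := by
  have h1 : ∀ n, ‖lam n‖ < 1 := fun n =>
    (hlam n).trans_le (Real.exp_le_one_iff.2 (by linarith))
  refine hasConvolution_delta_iff (g := gridG m h) hh
    (isCoprime_numPoly_nodePoly hm hh hK hinj hroot h0 hlam) (norm_gridG_le hm hh)
    (fun f s => summable_of_hasConvolution_gridG hm hh) (summable_explicitD h0 hlam) ?_ ?_ D
  · rw [← aeval_nodePoly_gridG hm hh, aeval_C_mul_apply]
  · rw [aeval_numPoly_explicitD hm hK hinj hroot h0 h1, aeval_C_mul_apply]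

end roots

/-! ### Real roots of the logistic polynomials -/

/-- The polynomials expressing the derivatives of a solution of `y' = y² - y` through `y`. -/
def logisticPoly : ℕ → ℝ[X]
  | 0 => X
  | n + 1 => (X ^ 2 - X) * derivative (logisticPoly n)

theorem logisticPoly_succ (n : ℕ) :
    logisticPoly (n + 1) = (X ^ 2 - X) * derivative (logisticPoly n) := rfl

theorem natDegree_X_sq_sub_X : (X ^ 2 - X : ℝ[X]).natDegree = 2 := by compute_degree!

theorem X_sq_sub_X_ne_zero : (X ^ 2 - X : ℝ[X]) ≠ 0 := fun h => by
  have := natDegree_X_sq_sub_X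
  simp [h] at this

theorem natDegree_logisticPoly (n : ℕ) :
    (logisticPoly n).natDegree = n + 1 ∧ derivative (logisticPoly n) ≠ 0 := by
  have hne : ∀ k, (logisticPoly k).natDegree = k + 1 → derivative (logisticPoly k) ≠ 0 := by
    intro k hk h0
    have := derivative_eq_zero.1 h0
    omega
  suffices (logisticPoly n).natDegree = n + 1 from ⟨this, hne n this⟩
  induction n with
  | zero => simp [logisticPoly]
  | succ n ih =>
    have hd := degree_derivative (p := logisticPoly n) (by omega)
    rw [logisticPoly_succ, natDegree_mul X_sq_sub_X_ne_zero (hne n ih), natDegree_X_sq_sub_X,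
      natDegree_eq_of_degree_eq_some hd, ih]
    omega

theorem logisticPoly_ne_zero (n : ℕ) : logisticPoly n ≠ 0 := fun h => by
  have := (natDegree_logisticPoly n).1
  simp [h] at this

/-- Rolle between the n + 1 roots in [0, 1] gives n roots of the derivative in the open interval,
and the factor X² − X adds 0 and 1. -/
theorem exists_roots_logisticPoly (n : ℕ) : ∃ S : Finset ℝ, n + 1 ≤ S.card ∧
    ∀ x ∈ S, x ∈ Set.Icc (0 : ℝ) 1 ∧ (logisticPoly n).IsRoot x := by
  induction n with
  | zero => exact ⟨{0}, by simp, by simp [logisticPoly]⟩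
  | succ n ih =>
    obtain ⟨S, hcard, hS⟩ := ih
    set t := (derivative (logisticPoly n)).roots.toFinset.filter (· ∈ Set.Ioo (0 : ℝ) 1) with ht
    have hmem : ∀ x, x ∈ t ↔ (derivative (logisticPoly n)).IsRoot x ∧ x ∈ Set.Ioo (0 : ℝ) 1 := by
      intro x
      simp [ht, (natDegree_logisticPoly n).2]
    have hle : S.card ≤ t.card + 1 := by
      refine Finset.card_le_of_interleaved fun x hx y hy hxy _ => ?_
      obtain ⟨z, hz, hz'⟩ := exists_deriv_eq_zero hxy (logisticPoly n).continuousOn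
        ((hS x hx).2.eq_zero.trans (hS y hy).2.eq_zero.symm)
      rw [Polynomial.deriv] at hz'
      exact ⟨z, (hmem z).2 ⟨hz', (hS x hx).1.1.trans_lt hz.1, hz.2.trans_le (hS y hy).1.2⟩, hz⟩
    have h1 : (1 : ℝ) ∉ t := fun h => lt_irrefl _ ((hmem 1).1 h).2.2
    have h0 : (0 : ℝ) ∉ insert 1 t := fun h => by
      rcases Finset.mem_insert.1 h with h | h
      · exact zero_ne_one h
      · exact lt_irrefl _ ((hmem 0).1 h).2.1
    refine ⟨insert 0 (insert 1 t), ?_, ?_⟩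
    · rw [Finset.card_insert_of_notMem h0, Finset.card_insert_of_notMem h1]
      omega
    · intro x hx
      rw [Finset.mem_insert, Finset.mem_insert] at hx
      rcases hx with rfl | rfl | hx
      · simp [logisticPoly_succ]
      · simp [logisticPoly_succ]
      · obtain ⟨hr, hI⟩ := (hmem x).1 hx
        refine ⟨⟨hI.1.le, hI.2.le⟩, ?_⟩
        rw [logisticPoly_succ, IsRoot, eval_mul, hr.eq_zero, mul_zero]

theorem roots_eq_of_natDegree_le {R : Type*} [CommRing R] [IsDomain R] {p : R[X]} (hp : p ≠ 0)
    {S : Finset R} (hS : ∀ x ∈ S, p.IsRoot x) (hcard : p.natDegree ≤ S.card) :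
    S.val = p.roots := by
  refine Multiset.eq_of_le_of_card_le ?_ ((card_roots' p).trans hcard)
  exact (Multiset.le_iff_subset S.nodup).2 fun x hx => (mem_roots hp).2 (hS x hx)

theorem eval_derivative_ne_zero_of_nodup {R : Type*} [CommRing R] [IsDomain R] {p : R[X]}
    (hp : p ≠ 0) (h : p.roots.Nodup) {x : R} (hx : p.IsRoot x) : (derivative p).eval x ≠ 0 := by
  classical
  intro h0
  have h1 := (one_lt_rootMultiplicity_iff_isRoot hp).2 ⟨hx, h0⟩
  rw [← count_roots] at h1
  exact absurd (Multiset.nodup_iff_count_le_one.1 h x) (not_le.2 h1)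

/-- X² − X is invariant under X ↦ 1 − X and each derivative contributes a sign. The index starts at
1 because `logisticPoly 0 = X` has no such symmetry. -/
theorem logisticPoly_comp (n : ℕ) :
    (logisticPoly (n + 1)).comp (1 - X) = (-1) ^ n * logisticPoly (n + 1) := by
  induction n with
  | zero => simp [logisticPoly]; ring
  | succ n ih =>
    have h := congrArg derivative ih
    rw [derivative_comp] at h
    have hc : derivative ((-1) ^ n * logisticPoly (n + 1) : ℝ[X]) =
        (-1) ^ n * derivative (logisticPoly (n + 1)) := by
      rw [show ((-1) ^ n : ℝ[X]) = C ((-1) ^ n) by simp, derivative_C_mul]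
    rw [hc] at h
    simp only [derivative_sub, derivative_one, derivative_X, zero_sub] at h
    rw [logisticPoly_succ (n + 1), mul_comp]
    simp only [sub_comp, pow_comp, X_comp]
    rw [pow_succ]
    linear_combination (-(X ^ 2 - X : ℝ[X])) * h

/-- The polynomial `logisticPoly (2 m - 1)` has `m - 1` simple roots in `(1/2, 1)`. -/
theorem exists_simple_roots_logisticPoly {m : ℕ} (hm : 0 < m) : ∃ x : Fin (m - 1) → ℝ,
    Function.Injective x ∧ ∀ i, x i ∈ Set.Ioo (1 / 2 : ℝ) 1 ∧
      (logisticPoly (2 * m - 1)).eval (x i) = 0 ∧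
      (derivative (logisticPoly (2 * m - 1))).eval (x i) ≠ 0 := by
  set p := logisticPoly (2 * m - 1) with hp
  have hp0 : p ≠ 0 := logisticPoly_ne_zero _
  have hdeg : p.natDegree = 2 * m := by rw [hp, (natDegree_logisticPoly _).1]; omega
  obtain ⟨S, hcard, hS⟩ := exists_roots_logisticPoly (2 * m - 1)
  have hroots := roots_eq_of_natDegree_le hp0 (fun x hx => (hS x hx).2) (by omega)
  have hmem : ∀ x, x ∈ S ↔ p.eval x = 0 := fun x => by
    rw [← Finset.mem_val, hroots, mem_roots hp0, IsRoot]
  have hnodup : p.roots.Nodup := hroots ▸ S.nodup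
  have hsymm : p.comp (1 - X) = p := by
    have := logisticPoly_comp (2 * m - 2)
    rw [show 2 * m - 2 + 1 = 2 * m - 1 by omega, (by exact ⟨m - 1, by omega⟩ :
      Even (2 * m - 2)).neg_one_pow, one_mul] at this
    exact this
  have heval : ∀ x, p.eval (1 - x) = p.eval x := fun x => by
    conv_rhs => rw [← hsymm]
    simp
  -- By symmetry the derivative vanishes at 1/2, so a root there would be multiple.
  have hhalf : (1 / 2 : ℝ) ∉ S := by
    intro hx
    refine eval_derivative_ne_zero_of_nodup hp0 hnodup ((hmem _).1 hx) ?_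
    have := congrArg (fun q => (derivative q).eval (1 / 2)) hsymm
    simp only [derivative_comp, derivative_sub, derivative_one, derivative_X, zero_sub, eval_mul,
      eval_neg, eval_one, eval_comp, eval_sub, eval_X] at this
    norm_num at this
    norm_num
    linarith
  have h1 : (1 : ℝ) ∈ S := by
    rw [hmem, hp, show 2 * m - 1 = 2 * m - 2 + 1 by omega, logisticPoly_succ]
    simp
  have hsplit : S.card = (S.filter (· < 1 / 2)).card + (S.filter (1 / 2 < ·)).card := by
    rw [← Finset.card_filter_add_card_filter_not (· < (1 / 2 : ℝ))]
    congr 2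
    refine Finset.filter_congr fun x hx => ?_
    rw [not_lt]
    exact ⟨fun h => lt_of_le_of_ne h fun he => hhalf (he ▸ hx), le_of_lt⟩
  have hrefl : (S.filter (· < 1 / 2)).card = (S.filter (1 / 2 < ·)).card := by
    refine Finset.card_bij' (fun x _ => 1 - x) (fun x _ => 1 - x) ?_ ?_ (by simp) (by simp)
    all_goals
      intro x hx
      rw [Finset.mem_filter, hmem] at hx ⊢
      exact ⟨(heval x).trans hx.1, by linarith [hx.2]⟩
  -- The 2m roots split evenly about 1/2. Of the m larger ones, 1 is discarded: it corresponds to z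
  -- = 0.
  have hT : m - 1 ≤ ((S.filter (1 / 2 < ·)).erase 1).card := by
    rw [Finset.card_erase_of_mem (Finset.mem_filter.2 ⟨h1, by norm_num⟩)]
    omega
  obtain ⟨T, hTsub, hTcard⟩ := Finset.exists_subset_card_eq hT
  refine ⟨fun i => T.equivFin.symm (i.cast hTcard.symm),
    fun i j hij => ?_, fun i => ?_⟩
  · simpa [Subtype.ext_iff.symm] using hij
  · have hx := hTsub (T.equivFin.symm (i.cast hTcard.symm)).2
    rw [Finset.mem_erase, Finset.mem_filter] at hx
    exact ⟨⟨hx.2.2, lt_of_le_of_ne (hS _ hx.2.1).1.2 hx.1⟩, (hmem _).1 hx.2.1,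
      eval_derivative_ne_zero_of_nodup hp0 hnodup ((hmem _).1 hx.2.1)⟩

/-- A polynomial changes its sign at a simple root. -/
theorem eventually_eval_mul_eval_neg {p : ℝ[X]} {x : ℝ} (h0 : p.eval x = 0)
    (h1 : (derivative p).eval x ≠ 0) :
    ∀ᶠ ε in nhdsWithin (0 : ℝ) (Set.Ioi 0), p.eval (x - ε) * p.eval (x + ε) < 0 := by
  obtain ⟨q, rfl⟩ := dvd_iff_isRoot.2 h0
  have hq : q.eval x ≠ 0 := by simpa using h1
  have hcont : Filter.Tendsto (fun ε : ℝ => q.eval (x - ε) * q.eval (x + ε))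
      (nhdsWithin 0 (Set.Ioi 0)) (nhds (q.eval x * q.eval x)) := by
    have : Continuous fun ε : ℝ => q.eval (x - ε) * q.eval (x + ε) := by fun_prop
    simpa using (this.tendsto 0).mono_left nhdsWithin_le_nhds
  filter_upwards [hcont.eventually_const_lt (mul_self_pos.2 hq), self_mem_nhdsWithin] with ε hε hpos
  simp only [eval_mul, eval_sub, eval_X, eval_C]
  have : 0 < ε ^ 2 := pow_pos hpos 2
  nlinarith [mul_pos this hε]

theorem exists_separating_radius {ι : Type*} [Finite ι] {x : ι → ℝ} (hx : Function.Injective x)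
    {a b : ℝ} (hI : ∀ i, x i ∈ Set.Ioo a b) {p : ℝ[X]} (h0 : ∀ i, p.eval (x i) = 0)
    (h1 : ∀ i, (derivative p).eval (x i) ≠ 0) :
    ∃ ε > 0, (∀ i, a < x i - ε ∧ x i + ε < b ∧ p.eval (x i - ε) * p.eval (x i + ε) < 0) ∧
      ∀ i j, i ≠ j → 2 * ε < |x i - x j| := by
  have hsmall : ∀ c : ℝ, 0 < c → ∀ᶠ ε in nhdsWithin (0 : ℝ) (Set.Ioi 0), ε < c := fun c hc =>
    nhdsWithin_le_nhds (eventually_lt_nhds hc)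
  have e1 : ∀ᶠ ε in nhdsWithin (0 : ℝ) (Set.Ioi 0), ∀ i,
      a < x i - ε ∧ x i + ε < b ∧ p.eval (x i - ε) * p.eval (x i + ε) < 0 := by
    rw [Filter.eventually_all]
    intro i
    filter_upwards [hsmall _ (sub_pos.2 (hI i).1), hsmall _ (sub_pos.2 (hI i).2),
      eventually_eval_mul_eval_neg (h0 i) (h1 i)] with ε ha hb hp
    exact ⟨by linarith, by linarith, hp⟩
  have e2 : ∀ᶠ ε in nhdsWithin (0 : ℝ) (Set.Ioi 0), ∀ i j, i ≠ j → 2 * ε < |x i - x j| := by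
    simp only [Filter.eventually_all]
    intro i j hij
    filter_upwards [hsmall (|x i - x j| / 2)
      (half_pos (abs_pos.2 (sub_ne_zero.2 (hx.ne hij))))] with ε hε
    linarith
  obtain ⟨ε, ⟨h1, h2⟩, hpos⟩ := ((e1.and e2).and self_mem_nhdsWithin).exists
  exact ⟨ε, hpos, h1, h2⟩

/-! ### Small-h asymptotics of sums over roots of unity -/

theorem halfRoot_pow_two_mul {m : ℕ} (n i : ℕ) :
    halfRoot m n ^ (2 * i) = (Complex.exp (2 * Real.pi * Complex.I / m) ^ i) ^ n := by
  rw [halfRoot, ← Complex.exp_nat_mul, ← Complex.exp_nat_mul, ← Complex.exp_nat_mul]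
  congr 1
  push_cast
  ring

theorem sum_halfRoot_pow {m i : ℕ} (hi : 0 < i) (him : i < m) :
    ∑ n ∈ Finset.range m, halfRoot m n ^ (2 * i) = 0 := by
  have hprim := Complex.isPrimitiveRoot_exp m (by omega)
  simp only [halfRoot_pow_two_mul]
  set ζ := Complex.exp (2 * Real.pi * Complex.I / m)
  have h1 : ζ ^ i ≠ 1 := hprim.pow_ne_one_of_pos_of_lt hi.ne' him
  have h2 := mul_geom_sum (ζ ^ i) m
  rw [← pow_mul, mul_comm i, pow_mul, hprim.pow_eq_one, one_pow, sub_self] at h2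
  exact (mul_eq_zero.1 h2).resolve_left (sub_ne_zero.2 h1)

theorem sum_halfRoot_pow_two_mul_self {m : ℕ} (hm : 0 < m) :
    ∑ n ∈ Finset.range m, halfRoot m n ^ (2 * m) = m := by
  have hprim := Complex.isPrimitiveRoot_exp m hm.ne'
  simp [halfRoot_pow_two_mul, hprim.pow_eq_one]

/-- The sum `∑ w φ(h w)` over all `2m`-th roots of unity `w`. -/
def rootSum (m : ℕ) (φ : ℂ → ℂ) (h : ℝ) : ℂ :=
  ∑ n ∈ Finset.range m, halfRoot m n * (φ (h * halfRoot m n) - φ (-(h * halfRoot m n)))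

theorem rootSum_add (m : ℕ) (φ ψ : ℂ → ℂ) (h : ℝ) :
    rootSum m (fun t => φ t + ψ t) h = rootSum m φ h + rootSum m ψ h := by
  simp only [rootSum, ← Finset.sum_add_distrib]
  exact Finset.sum_congr rfl fun n _ => by ring

/-- Even powers cancel between w and −w; for odd j < 2m the sum of w^(j+1) vanishes unless j + 1 =
2m. -/
theorem rootSum_poly {m : ℕ} (hm : 0 < m) (c : ℕ → ℂ) (h : ℝ) :
    rootSum m (fun t => ∑ j ∈ Finset.range (2 * m), c j * t ^ j) h =
      2 * m * c (2 * m - 1) * (h : ℂ) ^ (2 * m - 1) := by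
  have hsw : rootSum m (fun t => ∑ j ∈ Finset.range (2 * m), c j * t ^ j) h =
      ∑ j ∈ Finset.range (2 * m), c j * (h : ℂ) ^ j * (1 - (-1) ^ j) *
        ∑ n ∈ Finset.range m, halfRoot m n ^ (j + 1) := by
    simp only [rootSum, ← Finset.sum_sub_distrib, Finset.mul_sum]
    rw [Finset.sum_comm]
    refine Finset.sum_congr rfl fun j _ => Finset.sum_congr rfl fun n _ => ?_
    rw [neg_pow, mul_pow]
    ring
  rw [hsw, Finset.sum_eq_single (2 * m - 1)]
  · have hodd : Odd (2 * m - 1) := ⟨m - 1, by omega⟩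
    rw [show 2 * m - 1 + 1 = 2 * m by omega, sum_halfRoot_pow_two_mul_self hm, hodd.neg_one_pow]
    ring
  · intro j hj hne
    rw [Finset.mem_range] at hj
    rcases Nat.even_or_odd j with he | ho
    · simp [he.neg_one_pow]
    · obtain ⟨i, rfl⟩ := ho
      rw [show 2 * i + 1 + 1 = 2 * (i + 1) by ring, sum_halfRoot_pow (by omega) (by omega), mul_zero]
  · intro hj
    exact absurd (Finset.mem_range.2 (by omega)) hj

theorem tendsto_rootSum_zero {m N : ℕ} {φ : ℂ → ℂ}
    (hφ : (fun t => φ t) =O[nhds 0] fun t : ℂ => ‖t‖ ^ (N + 1)) :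
    Filter.Tendsto (fun h : ℝ => rootSum m φ h / (h : ℂ) ^ N)
      (nhdsWithin 0 (Set.Ioi 0)) (nhds 0) := by
  have hlim : ∀ w : ℂ, ‖w‖ = 1 → Filter.Tendsto (fun h : ℝ => φ (h * w) / (h : ℂ) ^ N)
      (nhdsWithin 0 (Set.Ioi 0)) (nhds 0) := by
    intro w hw
    have hc : Filter.Tendsto (fun h : ℝ => (h : ℂ) * w) (nhdsWithin 0 (Set.Ioi 0)) (nhds 0) := by
      have : Continuous fun h : ℝ => (h : ℂ) * w := by fun_prop
      simpa using (this.tendsto 0).mono_left nhdsWithin_le_nhds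
    obtain ⟨M, hM⟩ := (hφ.comp_tendsto hc).bound
    refine squeeze_zero_norm' (a := fun h : ℝ => M * h) ?_ ?_
    · filter_upwards [hM, self_mem_nhdsWithin] with h hb (hpos : 0 < h)
      simp only [Function.comp, norm_mul, hw, Complex.norm_real, mul_one, norm_pow,
        Real.norm_of_nonneg hpos.le] at hb
      rw [norm_div, norm_pow, Complex.norm_real, Real.norm_of_nonneg hpos.le,
        div_le_iff₀ (pow_pos hpos N)]
      calc _ ≤ _ := hb
        _ = _ := by ring
    · have : Continuous fun h : ℝ => M * h := by fun_prop
      simpa using (this.tendsto 0).mono_left nhdsWithin_le_nhds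
  have hsum := tendsto_finsetSum (Finset.range m) fun n _ =>
    ((hlim (halfRoot m n) (norm_halfRoot m n)).sub
      (hlim (-halfRoot m n) (by rw [norm_neg, norm_halfRoot]))).const_mul (halfRoot m n)
  simp only [sub_zero, mul_zero, Finset.sum_const_zero] at hsum
  refine hsum.congr fun h => ?_
  rw [rootSum, Finset.sum_div]
  refine Finset.sum_congr rfl fun n _ => ?_
  rw [mul_neg]
  ring

theorem tendsto_rootSum {m : ℕ} (hm : 0 < m) {φ : ℂ → ℂ} (hφ : AnalyticAt ℂ φ 0) :
    Filter.Tendsto (fun h : ℝ => rootSum m φ h / (h : ℂ) ^ (2 * m - 1))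
      (nhdsWithin 0 (Set.Ioi 0))
      (nhds (2 * m * (iteratedDeriv (2 * m - 1) φ 0 / (2 * m - 1).factorial))) := by
  set c : ℕ → ℂ := fun n => iteratedDeriv n φ 0 / n.factorial with hc
  have hO := hφ.hasFPowerSeriesAt.isBigO_sub_partialSum_pow (2 * m)
  simp only [zero_add, FormalMultilinearSeries.partialSum,
    FormalMultilinearSeries.ofScalars_apply_eq, smul_eq_mul] at hO
  have hO' : (fun t => φ t - ∑ j ∈ Finset.range (2 * m), c j * t ^ j) =O[nhds 0]
      fun t : ℂ => ‖t‖ ^ (2 * m - 1 + 1) := by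
    rw [show 2 * m - 1 + 1 = 2 * m by omega]
    exact hO
  have hlim := (tendsto_rootSum_zero (m := m) hO').add_const (2 * m * c (2 * m - 1))
  rw [zero_add] at hlim
  refine hlim.congr' ?_
  filter_upwards [self_mem_nhdsWithin] with h (hpos : 0 < h)
  have hne : (h : ℂ) ^ (2 * m - 1) ≠ 0 := pow_ne_zero _ (by exact_mod_cast hpos.ne')
  have hadd := rootSum_add m (fun t => φ t - ∑ j ∈ Finset.range (2 * m), c j * t ^ j)
    (fun t => ∑ j ∈ Finset.range (2 * m), c j * t ^ j) h
  simp only [sub_add_cancel] at hadd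
  rw [hadd, rootSum_poly hm, add_div, mul_div_cancel_right₀ _ hne]

/-- The function `t ↦ 1 / (1 - z e^t)`. -/
def logistic (z : ℂ) (t : ℂ) : ℂ := (1 - z * Complex.exp t)⁻¹

theorem hasDerivAt_logistic {z t : ℂ} (h : 1 - z * Complex.exp t ≠ 0) :
    HasDerivAt (logistic z) (logistic z t ^ 2 - logistic z t) t := by
  have h1 : HasDerivAt (fun t => 1 - z * Complex.exp t) (-(z * Complex.exp t)) t :=
    ((Complex.hasDerivAt_exp t).const_mul z).const_sub 1
  refine (h1.inv h).congr_deriv ?_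
  rw [logistic]
  field_simp
  ring

theorem eventually_one_sub_mul_exp_ne_zero {z : ℂ} (hz : z ≠ 1) :
    ∀ᶠ t in nhds (0 : ℂ), 1 - z * Complex.exp t ≠ 0 := by
  have : Continuous fun t => 1 - z * Complex.exp t := by fun_prop
  refine this.continuousAt.eventually_ne ?_
  simpa [sub_eq_zero] using hz.symm

theorem analyticAt_logistic {z : ℂ} (hz : z ≠ 1) : AnalyticAt ℂ (logistic z) 0 := by
  have : AnalyticAt ℂ (fun t => 1 - z * Complex.exp t) 0 := by fun_prop
  exact this.inv (by simpa [sub_eq_zero] using hz.symm)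

/-- By the chain rule along y' = y² − y, each differentiation applies the recursion of
`logisticPoly`. -/
theorem iteratedDeriv_logistic {z : ℂ} (hz : z ≠ 1) (n : ℕ) :
    iteratedDeriv n (logistic z) =ᶠ[nhds 0] fun t => aeval (logistic z t) (logisticPoly n) := by
  induction n with
  | zero => simp [logisticPoly]
  | succ n ih =>
    rw [iteratedDeriv_succ]
    refine ih.deriv.trans ?_
    filter_upwards [eventually_one_sub_mul_exp_ne_zero hz] with t ht
    have := ((logisticPoly n).hasDerivAt_aeval (logistic z t)).comp t (hasDerivAt_logistic ht)
    refine this.deriv.trans ?_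
    rw [logisticPoly_succ]
    simp [mul_comm]

/-- The parametrization z = 1 − 1/s is chosen so that the value 1/(1 − z) at t = 0 is s. -/
theorem iteratedDeriv_logistic_zero {s : ℝ} (hs : s ≠ 0) (n : ℕ) :
    iteratedDeriv n (logistic ((1 - s⁻¹ : ℝ) : ℂ)) 0 = (((logisticPoly n).eval s : ℝ) : ℂ) := by
  have hz : ((1 - s⁻¹ : ℝ) : ℂ) ≠ 1 := by
    intro h
    have : (1 - s⁻¹ : ℝ) = 1 := by exact_mod_cast h
    exact inv_ne_zero hs (by linarith)
  rw [(iteratedDeriv_logistic hz n).self_of_nhds]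
  have : logistic ((1 - s⁻¹ : ℝ) : ℂ) 0 = ((s : ℝ) : ℂ) := by
    simp [logistic]
  change aeval (logistic ((1 - s⁻¹ : ℝ) : ℂ) 0) (logisticPoly n) = _
  rw [this]
  exact aeval_algebraMap_apply_eq_algebraMap_eval s (logisticPoly n)

theorem logistic_sub_logistic_neg {z a : ℂ} (h : z ^ 2 - 2 * Complex.cosh a * z + 1 ≠ 0) :
    logistic z a - logistic z (-a) =
      2 * (z * Complex.sinh a / (z ^ 2 - 2 * Complex.cosh a * z + 1)) := by
  have he : Complex.exp a * Complex.exp (-a) = 1 := by rw [← Complex.exp_add]; simp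
  have hfac : z ^ 2 - 2 * Complex.cosh a * z + 1 =
      (1 - z * Complex.exp a) * (1 - z * Complex.exp (-a)) := by
    rw [Complex.cosh]
    linear_combination (-z ^ 2) * he
  rw [hfac] at h ⊢
  have h1 := left_ne_zero_of_mul h
  have h2 := right_ne_zero_of_mul h
  rw [logistic, logistic, Complex.sinh]
  field_simp
  ring

/-! ### Sign changes and negative roots of `P` -/

theorem node_quad_ne_zero {m : ℕ} {h : ℝ} (hh : 0 < h) {z : ℂ} (hz : ‖z‖ < Real.exp (-h)) (n : ℕ) :
    z ^ 2 - node m h n * z + 1 ≠ 0 :=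
  sq_sub_two_cosh_ne_zero (by simpa [norm_halfRoot, abs_of_pos hh] using hz)

theorem mul_aeval_P_eq_rootSum {m : ℕ} (hm : Odd m) {h : ℝ} (hh : 0 < h) {z : ℂ}
    (hz : ‖z‖ < Real.exp (-h)) : z * aeval z (P m h) =
      aeval z (quad h) * aeval z (B m h) * (rootSum m (logistic z) h / 2) := by
  rw [aeval_P hm, aeval_quad_mul_B hm, rootSum, Finset.sum_div, Finset.mul_sum, Finset.mul_sum]
  refine Finset.sum_congr rfl fun n hn => ?_
  have hne := node_quad_ne_zero (m := m) hh hz n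
  rw [logistic_sub_logistic_neg hne, ← Finset.mul_prod_erase _ _ hn, weight]
  change _ = _ * _ * (_ * (2 * (_ / (z ^ 2 - node m h n * z + 1))) / 2)
  generalize z ^ 2 - node m h n * z + 1 = q at hne ⊢
  generalize ∏ j ∈ (Finset.range m).erase n, (z ^ 2 - node m h j * z + 1) = r
  field_simp

theorem aeval_ofReal (p : ℝ[X]) (x : ℝ) : aeval (x : ℂ) p = ((p.eval x : ℝ) : ℂ) :=
  aeval_algebraMap_apply_eq_algebraMap_eval x p

/-- Every term of the quadratic is nonnegative for z < 0, and each quartic is the squared modulus of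
a nonvanishing complex quadratic. Hence dividing by quad · B preserves signs. -/
theorem eval_quad_mul_B_pos {m : ℕ} (hm : Odd m) {h : ℝ} (hh : 0 < h) {z : ℝ} (hz0 : z < 0)
    (hz : ‖(z : ℂ)‖ < Real.exp (-h)) : 0 < (quad h).eval z * (B m h).eval z := by
  have hq : 0 < (quad h).eval z := by
    simp only [quad, eval_add, eval_sub, eval_pow, eval_X, eval_mul, eval_C, eval_one]
    nlinarith [Real.cosh_pos h, sq_nonneg z]
  refine mul_pos hq ?_
  rw [B, eval_prod]
  refine Finset.prod_pos fun k hk => ?_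
  have hkm := le_of_mem_idx hk
  have h1 := aeval_quartic_eq hm.pos hkm h (z : ℂ)
  have h2 : (z : ℂ) ^ 2 - node m h (m - k) * z + 1 =
      (starRingEnd ℂ) ((z : ℂ) ^ 2 - node m h k * z + 1) := by
    simp [node_sub hm.pos hkm]
  rw [h2, Complex.mul_conj, aeval_ofReal] at h1
  rw [Complex.ofReal_injective h1]
  exact Complex.normSq_pos.2 (node_quad_ne_zero hh hz k)

/-- For small `h` the sign of `z 𝒫(z)` at `z = 1 - 1/s` is that of `logisticPoly (2 m - 1)` at `s`. -/
theorem eventually_sign_P {m : ℕ} (hm : Odd m) {s : ℝ} (hs : s ∈ Set.Ioo (1 / 2 : ℝ) 1)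
    (hne : (logisticPoly (2 * m - 1)).eval s ≠ 0) :
    ∀ᶠ h in nhdsWithin (0 : ℝ) (Set.Ioi 0), 0 < (logisticPoly (2 * m - 1)).eval s *
      ((1 - s⁻¹) * (P m h).eval (1 - s⁻¹)) := by
  have hs0 : 0 < s := by linarith [hs.1]
  set z : ℝ := 1 - s⁻¹ with hz
  have hz0 : z < 0 := sub_neg.2 ((one_lt_inv₀ hs0).2 hs.2)
  have hz1 : -1 < z := by
    have : s⁻¹ < 2 := by
      rw [inv_lt_comm₀ hs0 two_pos]
      linarith [hs.1]
    linarith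
  have hzc : (z : ℂ) ≠ 1 := by
    intro h
    have : z = 1 := by exact_mod_cast h
    linarith
  have hnorm : ‖(z : ℂ)‖ = -z := by rw [Complex.norm_real, Real.norm_of_nonpos hz0.le]
  have hlim := tendsto_rootSum hm.pos (analyticAt_logistic hzc)
  rw [hz, iteratedDeriv_logistic_zero hs0.ne', ← hz] at hlim
  have hexp : ∀ᶠ h in nhdsWithin (0 : ℝ) (Set.Ioi 0), -z < Real.exp (-h) := by
    have : Continuous fun h : ℝ => Real.exp (-h) := by fun_prop
    have ht := (this.tendsto 0).mono_left (nhdsWithin_le_nhds (s := Set.Ioi 0))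
    rw [neg_zero, Real.exp_zero] at ht
    exact ht.eventually_const_lt (by linarith)
  set ρ : ℝ → ℝ := fun h => z * (P m h).eval z / ((quad h).eval z * (B m h).eval z) with hρ
  have hlim' : Filter.Tendsto (fun h : ℝ => (logisticPoly (2 * m - 1)).eval s *
      (2 * ρ h / h ^ (2 * m - 1))) (nhdsWithin 0 (Set.Ioi 0))
      (nhds ((logisticPoly (2 * m - 1)).eval s *
        (2 * m * ((logisticPoly (2 * m - 1)).eval s / (2 * m - 1).factorial)))) := by
    refine Filter.Tendsto.const_mul _ ?_
    have hre := (Complex.continuous_re.tendsto _).comp hlim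
    have hval : (2 * m * ((((logisticPoly (2 * m - 1)).eval s : ℝ) : ℂ) /
        (2 * m - 1).factorial) : ℂ).re =
        2 * m * ((logisticPoly (2 * m - 1)).eval s / (2 * m - 1).factorial) := by
      rw [← Complex.ofReal_re (2 * m * ((logisticPoly (2 * m - 1)).eval s / (2 * m - 1).factorial))]
      push_cast
      rfl
    rw [hval] at hre
    refine hre.congr' ?_
    filter_upwards [hexp, self_mem_nhdsWithin] with h he (hpos : 0 < h)
    rw [← hnorm] at he
    have hB := eval_quad_mul_B_pos hm hpos hz0 he
    have hBc : (((quad h).eval z * (B m h).eval z : ℝ) : ℂ) ≠ 0 := by exact_mod_cast hB.ne'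
    have hP := mul_aeval_P_eq_rootSum hm hpos he
    rw [aeval_ofReal, aeval_ofReal, aeval_ofReal, ← Complex.ofReal_mul, ← Complex.ofReal_mul] at hP
    have hroot : rootSum m (logistic z) h = ((2 * ρ h : ℝ) : ℂ) := by
      rw [hρ, Complex.ofReal_mul, Complex.ofReal_div, hP, mul_div_cancel_left₀ _ hBc]
      push_cast
      ring
    rw [Function.comp, hroot, ← Complex.ofReal_pow, ← Complex.ofReal_div, Complex.ofReal_re]
  have hpos : 0 < (logisticPoly (2 * m - 1)).eval s *
      (2 * m * ((logisticPoly (2 * m - 1)).eval s / (2 * m - 1).factorial)) := by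
    have h1 : (0 : ℝ) < (2 * m - 1).factorial := by exact_mod_cast Nat.factorial_pos _
    have h2 : (0 : ℝ) < m := by exact_mod_cast hm.pos
    have h3 := mul_self_pos.2 hne
    rw [show (logisticPoly (2 * m - 1)).eval s *
      (2 * m * ((logisticPoly (2 * m - 1)).eval s / (2 * m - 1).factorial)) =
      (logisticPoly (2 * m - 1)).eval s * (logisticPoly (2 * m - 1)).eval s *
        (2 * m / (2 * m - 1).factorial) by ring]
    positivity
  filter_upwards [hlim'.eventually_const_lt hpos, hexp, self_mem_nhdsWithin] with h hl he
    (hh : 0 < h)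
  rw [← hnorm] at he
  have hB := eval_quad_mul_B_pos hm hh hz0 he
  have hexpr : (logisticPoly (2 * m - 1)).eval s * (z * (P m h).eval z) =
      (logisticPoly (2 * m - 1)).eval s * (2 * ρ h / h ^ (2 * m - 1)) *
        (h ^ (2 * m - 1) * ((quad h).eval z * (B m h).eval z) / 2) := by
    rw [hρ]
    have := hB.ne'
    dsimp only
    generalize (quad h).eval z * (B m h).eval z = q at this ⊢
    field_simp
  rw [hexpr]
  positivity

/-- The other solution w = 1/z would lie outside the disc. -/
theorem eq_of_add_inv_eq {z w : ℂ} (hz : z ≠ 0) (hw : w ≠ 0) (hz1 : ‖z‖ < 1) (hw1 : ‖w‖ < 1)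
    (h : z + z⁻¹ = w + w⁻¹) : z = w := by
  have hfac : (z - w) * (z * w - 1) = 0 := by
    field_simp at h
    linear_combination h
  rcases mul_eq_zero.1 hfac with h0 | h0
  · exact sub_eq_zero.1 h0
  · have h1 : ‖z‖ * ‖w‖ = 1 := by rw [← norm_mul, sub_eq_zero.1 h0, norm_one]
    nlinarith [norm_nonneg z, norm_nonneg w]

theorem aeval_zero_P {m : ℕ} (hm : Odd m) (h : ℝ) : aeval (0 : ℂ) (P m h) = K m h := by
  simp [aeval_P hm, K_eq hm]

theorem exists_root_of_sign_change {f : ℝ → ℝ} {a b : ℝ} (hf : ContinuousOn f (Set.Icc a b))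
    (hab : a ≤ b) (h : f a * f b < 0) : ∃ x ∈ Set.Icc a b, f x = 0 := by
  rw [← Set.uIcc_of_le hab] at hf ⊢
  have h0 : (0 : ℝ) ∈ Set.uIcc (f a) (f b) := by
    rw [Set.mem_uIcc]
    rcases mul_neg_iff.1 h with h | h
    · exact Or.inr ⟨h.2.le, h.1.le⟩
    · exact Or.inl ⟨h.1.le, h.2.le⟩
  exact intermediate_value_uIcc hf h0

/-- For all small `h`, the polynomial `𝒫` has `m - 1` distinct negative roots close to `0`, and
does not vanish identically. -/
theorem eventually_exists_roots {m : ℕ} (hm : Odd m) :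
    ∀ᶠ h in nhdsWithin (0 : ℝ) (Set.Ioi 0), (∃ z : ℝ, z ≠ 0 ∧ (P m h).eval z ≠ 0) ∧
      ∃ lam : Fin (m - 1) → ℝ, Function.Injective lam ∧
        ∀ i, lam i ≠ 0 ∧ |lam i| < Real.exp (-h) ∧ (P m h).eval (lam i) = 0 := by
  obtain ⟨x, hinj, hx⟩ := exists_simple_roots_logisticPoly hm.pos
  obtain ⟨ε, hε, hε1, hε2⟩ := exists_separating_radius hinj (fun i => (hx i).1)
    (fun i => (hx i).2.1) (fun i => (hx i).2.2)
  set p := logisticPoly (2 * m - 1) with hp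
  -- A sample point where the leading term does not vanish certifies P ≠ 0, also for m = 1, when
  -- there are no roots to bracket.
  obtain ⟨s₀, hs₀, hs₀'⟩ := (Set.Ioo_infinite (by norm_num : (1 / 2 : ℝ) < 1)).exists_notMem_finset
    p.roots.toFinset
  have hps₀ : p.eval s₀ ≠ 0 := by
    simpa [logisticPoly_ne_zero, hp] using hs₀'
  have hleft : ∀ i, x i - ε ∈ Set.Ioo (1 / 2 : ℝ) 1 := fun i =>
    ⟨(hε1 i).1, by linarith [(hε1 i).2.1]⟩
  have hright : ∀ i, x i + ε ∈ Set.Ioo (1 / 2 : ℝ) 1 := fun i =>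
    ⟨by linarith [(hε1 i).1], (hε1 i).2.1⟩
  have e1 := Filter.eventually_all.2 fun i =>
    eventually_sign_P hm (hleft i) (left_ne_zero_of_mul (hε1 i).2.2.ne)
  have e2 := Filter.eventually_all.2 fun i =>
    eventually_sign_P hm (hright i) (right_ne_zero_of_mul (hε1 i).2.2.ne)
  -- On the bracket, |1 − 1/s| = 1/s − 1 is largest at the left end, where it is below 1 because s >
  -- 1/2.
  have e3 : ∀ᶠ h in nhdsWithin (0 : ℝ) (Set.Ioi 0), ∀ i, (x i - ε)⁻¹ - 1 < Real.exp (-h) := by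
    rw [Filter.eventually_all]
    intro i
    have : Continuous fun h : ℝ => Real.exp (-h) := by fun_prop
    have ht := (this.tendsto 0).mono_left (nhdsWithin_le_nhds (s := Set.Ioi 0))
    rw [neg_zero, Real.exp_zero] at ht
    refine ht.eventually_const_lt ?_
    have : (x i - ε)⁻¹ < 2 := by
      rw [inv_lt_comm₀ (by linarith [(hleft i).1]) two_pos]
      linarith [(hleft i).1]
    linarith
  filter_upwards [e1, e2, e3, eventually_sign_P hm hs₀ hps₀] with h h1 h2 h3 h4
  refine ⟨⟨1 - s₀⁻¹, ?_, ?_⟩, ?_⟩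
  · exact left_ne_zero_of_mul (right_ne_zero_of_mul h4.ne')
  · exact right_ne_zero_of_mul (right_ne_zero_of_mul h4.ne')
  have hroot : ∀ i, ∃ s ∈ Set.Icc (x i - ε) (x i + ε),
      (1 - s⁻¹) * (P m h).eval (1 - s⁻¹) = 0 := by
    intro i
    refine exists_root_of_sign_change (f := fun s => (1 - s⁻¹) * (P m h).eval (1 - s⁻¹)) ?_
      (by linarith) ?_
    · have hc : ContinuousOn (fun s : ℝ => 1 - s⁻¹) (Set.Icc (x i - ε) (x i + ε)) :=
        continuousOn_const.sub (continuousOn_inv₀.mono fun s hs => by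
          have := hs.1
          have := (hleft i).1
          exact (by linarith : (0 : ℝ) < s).ne')
      exact hc.mul ((P m h).continuous.comp_continuousOn hc)
    -- The function agrees in sign with the logistic polynomial at both ends, and that polynomial
    -- changes sign across the bracket.
    · have h5 := mul_pos (h1 i) (h2 i)
      have h6 := (hε1 i).2.2
      by_contra hcon
      rw [not_lt] at hcon
      have h7 := mul_nonpos_of_nonpos_of_nonneg h6.le hcon
      refine absurd h5 (not_lt.2 (le_of_eq_of_le ?_ h7))
      ring
  choose s hs hs0 using hroot
  have hspos : ∀ i, 1 / 2 < s i := fun i => (hleft i).1.trans_le (hs i).1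
  have hslt : ∀ i, s i < 1 := fun i => (hs i).2.trans_lt (hright i).2
  have hneg : ∀ i, 1 - (s i)⁻¹ < 0 := fun i =>
    sub_neg.2 ((one_lt_inv₀ (by linarith [hspos i])).2 (hslt i))
  refine ⟨fun i => 1 - (s i)⁻¹, fun i j hij => ?_, fun i => ⟨(hneg i).ne, ?_, ?_⟩⟩
  · have hsij : s i = s j := inv_injective (by simpa using hij)
    by_contra hne
    refine absurd (hε2 i j hne) (not_lt.2 (abs_le.2 ?_))
    constructor <;> linarith [(hs i).1, (hs i).2, (hs j).1, (hs j).2]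
  · rw [abs_of_neg (hneg i), neg_sub]
    refine lt_of_le_of_lt (sub_le_sub_right ?_ 1) (h3 i)
    exact inv_anti₀ (by linarith [(hleft i).1]) (hs i).1
  · exact (mul_eq_zero.1 (hs0 i)).resolve_left (hneg i).ne

end DiscreteAnalogue

end

/-! ### Assembly of the theorem -/

/-- For every odd `m` and every sufficiently small `h > 0`: `K ≠ 0`, the polynomial `𝒫_{2m-2}` has
exactly `m - 1` distinct roots `λ_n` in the open unit disc, all of them nonzero and simple, and a
discrete function solves `D(hβ) * G_m(hβ) = δ_d(hβ)` if and only if it is the explicit one. -/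
theorem theorem2 (m : ℕ) (hm : Odd m) :
    ∃ h₀ : ℝ, 0 < h₀ ∧ ∀ h : ℝ, 0 < h → h < h₀ →
      DiscreteAnalogue.K m h ≠ 0 ∧
      ∃ lam : Fin (m - 1) → ℂ,
        Function.Injective lam ∧
        (∀ z : ℂ, (Polynomial.aeval z (DiscreteAnalogue.P m h) = 0 ∧ ‖z‖ < 1) ↔
          ∃ n, lam n = z) ∧
        (∀ n, lam n ≠ 0 ∧
          Polynomial.aeval (lam n) (Polynomial.derivative (DiscreteAnalogue.P m h)) ≠ 0) ∧
        ∀ D : ℤ → ℂ, DiscreteAnalogue.IsDiscreteAnalogue m h D ↔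
          D = DiscreteAnalogue.explicitD m h lam := by
  obtain ⟨h₀, hh₀, hev⟩ :=
    (mem_nhdsGT_iff_exists_Ioo_subset).1 (DiscreteAnalogue.eventually_exists_roots hm)
  refine ⟨h₀, hh₀, fun h hpos hlt => ?_⟩
  obtain ⟨⟨y, hy0, hy⟩, μ, hμ, hprop⟩ := hev ⟨hpos, hlt⟩
  set lam : Fin (m - 1) → ℂ := fun n => (μ n : ℂ) with hlam
  have h0 : ∀ n, lam n ≠ 0 := fun n => Complex.ofReal_ne_zero.2 (hprop n).1
  have hsmall : ∀ n, ‖lam n‖ < Real.exp (-h) := fun n => by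
    simpa [hlam] using (hprop n).2.1
  have h1 : ∀ n, ‖lam n‖ < 1 := fun n =>
    (hsmall n).trans_le (Real.exp_le_one_iff.2 (by linarith))
  have hinj : Function.Injective lam := Complex.ofReal_injective.comp hμ
  have hinj' : Function.Injective fun n => lam n + (lam n)⁻¹ := fun i j hij =>
    hinj (DiscreteAnalogue.eq_of_add_inv_eq (h0 i) (h0 j) (h1 i) (h1 j) hij)
  have hP : ∀ n, aeval (lam n) (DiscreteAnalogue.P m h) = 0 := fun n => by
    rw [hlam, DiscreteAnalogue.aeval_ofReal, (hprop n).2.2, Complex.ofReal_zero]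
  have hroot : ∀ n, (DiscreteAnalogue.numPoly m h).eval (lam n + (lam n)⁻¹) = 0 := fun n => by
    have := hP n
    rw [DiscreteAnalogue.aeval_P_eq_numPoly hm h (h0 n)] at this
    exact (mul_eq_zero.1 this).resolve_left (pow_ne_zero _ (h0 n))
  have hnum := DiscreteAnalogue.numPoly_eq hm hinj' hroot
  -- If K were 0, the factorization would make R zero, and then P would vanish at the nonzero point
  -- y.
  have hK : DiscreteAnalogue.K m h ≠ 0 := by
    intro hK
    have h2 := DiscreteAnalogue.aeval_P_eq_numPoly hm h (Complex.ofReal_ne_zero.2 hy0)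
    rw [hnum, hK, DiscreteAnalogue.aeval_ofReal] at h2
    simp at h2
    exact hy h2
  refine ⟨hK, lam, hinj, fun z => ⟨?_, ?_⟩, fun n => ⟨h0 n,
    DiscreteAnalogue.aeval_derivative_P_ne_zero hm hK hinj' hroot h0 h1 n⟩,
    DiscreteAnalogue.isDiscreteAnalogue_iff hm hpos hK hinj' hroot h0 hsmall⟩
  · rintro ⟨hz, hz1⟩
    -- The value of P at 0 is K.
    have hz0 : z ≠ 0 := by
      rintro rfl
      rw [DiscreteAnalogue.aeval_zero_P hm] at hz
      exact hK (by exact_mod_cast hz)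
    rw [DiscreteAnalogue.aeval_P_eq_numPoly hm h hz0, hnum] at hz
    simp only [mul_eq_zero, pow_eq_zero_iff', hz0, false_and, false_or, eval_mul, eval_C,
      Complex.ofReal_eq_zero, hK, eval_prod, Finset.prod_eq_zero_iff, Finset.mem_univ, true_and,
      eval_sub, eval_X, sub_eq_zero] at hz
    obtain ⟨n, hn⟩ := hz
    exact ⟨n, (DiscreteAnalogue.eq_of_add_inv_eq hz0 (h0 n) hz1 (h1 n) hn).symm⟩
  · rintro ⟨n, rfl⟩
    exact ⟨hP n, h1 n⟩
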